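/- For $0<\alpha<1$ let $S(\alpha,1,1)$ denote the maximally skewed $\alpha$-stable law of unit scale, i.e. the probability law on $\mathbb{R}$ with characteristic function $\lambda\mapsto\exp\left(-|\lambda|^\alpha\left(1-\sqrt{-1}\,\mathrm{sign}(\lambda)\tan\frac{\pi\alpha}{2}\right)\right)$, and for $t\ge 0$ let $$F_\alpha(t)=\mathbf{Pr}\left((S_2/S_1)^{\alpha/(1-\alpha)}\le t\right),\qquad S_1,S_2\sim S(\alpha,1,1)\ \text{i.i.d.}$$ Let $N,M\ge 1$, let $x\in\mathbb{R}^N$ have nonnegative entries, let $s_{ij}\sim S(\alpha,1,1)$ be i.i.d. ($1\le i\le N$, $1\le j\le M$), let $y_j=\sum_{l=1}^N x_l s_{lj}$, and let $\hat{x}_{i,min}=\min_{1\le j\le M} y_j/s_{ij}$. Fix $i$, put $\theta_i=\left(\sum_{l\ne i}x_l^\alpha\right)^{1/\alpha}$ and assume $\theta_i>0$. Then for every $\epsilon\ge 0$: (1) $\displaystyle \mathbf{Pr}\left(\hat{x}_{i,min}-x_i\ge\epsilon\right)=\left[1-F_\alpha\left((\epsilon/\theta_i)^{\alpha/(1-\alpha)}\right)\right]^M$.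 (2) If $\epsilon\le\theta_i$, then $\displaystyle \mathbf{Pr}\left(\hat{x}_{i,min}-x_i\ge\epsilon\right)\le\left[\frac{1}{1+(\epsilon/\theta_i)^{\alpha/(1-\alpha)}}\right]^M$. (3) If $0<\alpha\le 0.5$ and $\epsilon/\theta_i<\alpha$, then $\displaystyle \mathbf{Pr}\left(\hat{x}_{i,min}-x_i\ge\epsilon\right)=\left[1-\Theta\left(\epsilon^\alpha/\theta_i^\alpha\right)\right]^M$. That is, there are absolute constants $0<c\le C$ (independent of $\alpha,\epsilon,x,i,N,M$) such that $c\,\epsilon^\alpha/\theta_i^\alpha\le F_\alpha\left((\epsilon/\theta_i)^{\alpha/(1-\alpha)}\right)\le C\,\epsilon^\alpha/\theta_i^\alpha$, where by (1) the probability is $\left[1-F_\alpha\left((\epsilon/\theta_i)^{\alpha/(1-\alpha)}\right)\right]^M$. (4) If $\alpha=0.5$, then $\displaystyle \mathbf{Pr}\left(\hat{x}_{i,min}-x_i\ge\epsilon\right)=\left[1-\frac{2}{\pi}\arctan\sqrt{\frac{\epsilon}{\theta_i}}\right]^M$. -/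

import Mathlib

open MeasureTheory ProbabilityTheory

/-- `μ` is the maximally skewed `α`-stable law `S(α, 1, 1)` (skewness one, unit scale): the
probability measure on `ℝ` with characteristic function
`exp (-|l|^α * (1 - sign l * √(-1) * tan (π α / 2)))`. Such a law is unique, because a finite
measure on `ℝ` is determined by its characteristic function. -/
structure IsMaxSkewedStable (α : ℝ) (μ : Measure ℝ) : Prop where
  isProbabilityMeasure : IsProbabilityMeasure μ
  charFun_eq : ∀ l : ℝ, charFun μ l =
    Complex.exp (-((|l| ^ α : ℝ) : ℂ) *
      (1 - ((Real.sign l : ℝ) : ℂ) * Complex.I * ((Real.tan (Real.pi * α / 2) : ℝ) : ℂ)))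

/-- `F_α(t) = Pr ((S₂ / S₁) ^ (α / (1 - α)) ≤ t)`, where `S₁, S₂` are independent with common
law `μ`; it is used only with `μ` the law `S(α, 1, 1)`. -/
noncomputable def ratioCDF (α : ℝ) (μ : Measure ℝ) (t : ℝ) : ℝ :=
  (μ.prod μ).real {S : ℝ × ℝ | (S.2 / S.1) ^ (α / (1 - α)) ≤ t}

/-- The entries `s i j` of the random `N × M` design matrix are i.i.d. with law `μ`. -/
structure IsIIDDesign {Ω : Type*} [MeasurableSpace Ω] (P : Measure Ω) (μ : Measure ℝ)
    {N M : ℕ} (s : Fin N → Fin M → Ω → ℝ) : Prop where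
  hasLaw : ∀ i j, HasLaw (s i j) μ P
  indep : iIndepFun (fun p : Fin N × Fin M => s p.1 p.2) P

/-- The linear measurement `y_j = ∑ i, x_i * s_{ij}`. -/
noncomputable def measurement {Ω : Type*} {N M : ℕ} (x : Fin N → ℝ)
    (s : Fin N → Fin M → Ω → ℝ) (j : Fin M) (ω : Ω) : ℝ :=
  ∑ i, x i * s i j ω

/-- The minimum estimator `min_j y_j / s_{ij}` of the coordinate `x_i`
(a genuine minimum as soon as `0 < M`). -/
noncomputable def minEstimator {Ω : Type*} {N M : ℕ} (x : Fin N → ℝ)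
    (s : Fin N → Fin M → Ω → ℝ) (i : Fin N) (ω : Ω) : ℝ :=
  ⨅ j : Fin M, measurement x s j ω / s i j ω

/-- `θ_i = (∑_{l ≠ i} x_l ^ α) ^ (1 / α)`. -/
noncomputable def thetaExcept {N : ℕ} (α : ℝ) (x : Fin N → ℝ) (i : Fin N) : ℝ :=
  (∑ l ∈ Finset.univ.erase i, x l ^ α) ^ (1 / α)

/-- The tail probability `Pr (x̂_{i,min} - x_i ≥ ε)`. -/
noncomputable def minEstimatorTail {Ω : Type*} [MeasurableSpace Ω] (P : Measure Ω)
    {N M : ℕ} (x : Fin N → ℝ) (s : Fin N → Fin M → Ω → ℝ) (i : Fin N) (ε : ℝ) : ℝ :=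
  P.real {ω | minEstimator x s i ω - x i ≥ ε}

open Filter Topology Set

/-! Write `S₁, S₂` for independent copies of the stable law. By stability (`map_sum_mul`,
`map_entry_sum`) the sum over `l ≠ i` in a column is distributed as `θ_i S₂`, independently of the
entry `S₁`, so `y_j / s_ij - x_i` has the law of `θ_i S₂ / S₁`. The columns are independent, hence
the tail is the `M`-th power of a one-column probability, and everything reduces to the distribution
function of `S₂ / S₁`.

That function is explicit: at `r` it equals `arg (1 + r^α e^{iπα}) / (πα)` (`ratioLaw_Iio`). The
characteristic function is `exp (-k (-il)^α)` with `k = 1 / cos (πα/2)`. Rotating a contour shows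
that the Cauchy transform extends smoothly across the negative axis with real boundary values, so
the law lives on `[0, ∞)`. Phragmén–Lindelöf then gives the Laplace transform `exp (-k z^α)`, which
also excludes an atom at `0`. A Laplace-type integral yields `E (w + S₂/S₁)⁻¹ = w^(α-1) / (1 +
w^α)`. This extends to the slit plane and has primitive `log (1 + z^α) / α`; Stieltjes inversion
reads the distribution function off the boundary argument.

The bounds are plane trigonometry. With `θ = πα`, `φ` the argument above and `s = φ/θ`, the law of
sines gives `r^α = sin (θs) / sin (θ(1-s))`. The bound for `ε ≤ θ_i` is `r^(α/(1-α)) ≤ s/(1-s)`,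
which follows from a convexity in `α` (`convexOn_log_sinc_sub`). The order `r^α` comes from
elementary estimates of `sin` and `tan`, and at `α = 1/2` simply `tan φ = √r`. -/

/-! ### Contour rotation for the Laplace kernel -/

lemma re_cpow_ofReal_nonneg {α : ℝ} (h0 : 0 < α) (h1 : α < 1) {z : ℂ} (hz : 0 ≤ z.re) :
    0 ≤ (z ^ (α : ℂ)).re := by
  rw [Complex.cpow_ofReal_re]
  have := abs_le.1 (Complex.abs_arg_le_pi_div_two_iff.2 hz)
  have hpi := Real.pi_pos
  refine mul_nonneg (by positivity) (Real.cos_nonneg_of_neg_pi_div_two_le_of_le ?_ ?_) <;> nlinarith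

lemma norm_exp_neg_cpow_le_one {α k : ℝ} (h0 : 0 < α) (h1 : α < 1) (hk : 0 ≤ k) {z : ℂ}
    (hz : 0 ≤ z.re) : ‖Complex.exp (-(k * z ^ (α : ℂ)))‖ ≤ 1 := by
  rw [Complex.norm_exp, Real.exp_le_one_iff]
  simpa using mul_nonneg hk (re_cpow_ofReal_nonneg h0 h1 hz)

lemma norm_cpow_ofReal_le_one_add {α : ℝ} (h0 : 0 < α) (h1 : α < 1) (z : ℂ) :
    ‖z ^ (α : ℂ)‖ ≤ 1 + ‖z‖ := by
  rw [Complex.norm_cpow_real]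
  rcases le_total ‖z‖ 1 with h | h
  · have := Real.rpow_le_one (norm_nonneg z) h h0.le
    linarith [norm_nonneg z]
  · have := Real.rpow_le_rpow_of_exponent_le h h1.le
    rw [Real.rpow_one] at this
    linarith

/-- The Laplace integrand `exp (-w z - k z ^ α)`. -/
noncomputable def laplaceKernel (α k : ℝ) (w z : ℂ) : ℂ :=
  Complex.exp (-(w * z)) * Complex.exp (-(k * z ^ (α : ℂ)))

lemma norm_laplaceKernel_le {α k : ℝ} (h0 : 0 < α) (h1 : α < 1) (hk : 0 ≤ k) (w : ℂ) {z : ℂ}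
    (hz : 0 ≤ z.re) : ‖laplaceKernel α k w z‖ ≤ Real.exp (-(w * z).re) := by
  rw [laplaceKernel, norm_mul, Complex.norm_exp]
  simpa using mul_le_mul_of_nonneg_left (norm_exp_neg_cpow_le_one h0 h1 hk hz)
    (Real.exp_nonneg (-(w * z).re))

lemma hasDerivAt_laplaceKernel (α k : ℝ) (w : ℂ) {z : ℂ} (hz : 0 < z.re) :
    HasDerivAt (laplaceKernel α k w)
      (laplaceKernel α k w z * (-w - k * (α * z ^ ((α : ℂ) - 1)))) z := by
  have h := (((hasDerivAt_id z).const_mul w).neg.cexp).mul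
    (((hasDerivAt_id z).cpow_const (c := (α : ℂ)) (Or.inl hz)).const_mul (k : ℂ)).neg.cexp
  refine h.congr_deriv ?_
  simp only [laplaceKernel, id, Pi.neg_apply]
  ring

lemma cpow_sub_one_mul_self {α : ℝ} {z : ℂ} (hz : z ≠ 0) :
    z ^ ((α : ℂ) - 1) * z = z ^ (α : ℂ) := by
  rw [Complex.cpow_sub _ _ hz, Complex.cpow_one, div_mul_cancel₀ _ hz]

lemma integrableOn_affine_mul_exp_neg (A D : ℝ) {m : ℝ} (hm : 0 < m) :
    IntegrableOn (fun r : ℝ => Real.exp (-(m * r)) * (A + D * r)) (Ioi 0) := by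
  have h1 := (integrableOn_rpow_mul_exp_neg_mul_rpow (p := 1) (s := 0) (b := m)
    (by norm_num) (by norm_num) hm).const_mul A
  have h2 := (integrableOn_rpow_mul_exp_neg_mul_rpow (p := 1) (s := 1) (b := m)
    (by norm_num) (by norm_num) hm).const_mul D
  refine (h1.add h2).congr ?_
  filter_upwards with r
  simp only [Real.rpow_zero, Real.rpow_one, Pi.add_apply, one_mul, neg_mul]
  ring

lemma continuousOn_laplaceKernel (α k : ℝ) (w : ℂ) :
    ContinuousOn (laplaceKernel α k w) Complex.slitPlane := by
  unfold laplaceKernel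
  refine ContinuousOn.mul (by fun_prop) ?_
  exact ((continuousOn_const.mul
    (continuousOn_id.cpow_const fun z hz => hz)).neg).cexp

lemma measurable_laplaceKernel (α k : ℝ) (w : ℂ) : Measurable (laplaceKernel α k w) := by
  unfold laplaceKernel
  fun_prop

/-- The Laplace integral along the ray through `q` is locally independent of `q`. -/
lemma hasDerivAt_rayIntegral {α k : ℝ} (h0 : 0 < α) (h1 : α < 1) (hk : 0 ≤ k) {w q₀ : ℂ}
    (hq : 0 < q₀.re) (hwq : 0 < (w * q₀).re) :
    HasDerivAt (fun q : ℂ => ∫ r in Ioi (0 : ℝ), q * laplaceKernel α k w (q * r)) 0 q₀ := by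
  set m := (w * q₀).re / 2 with hm
  have hm0 : 0 < m := by positivity
  set B := ‖q₀‖ + 1 with hB
  -- On this neighbourhood the kernel decays at least like `exp (-m r)`, uniformly in `q`; halving
  -- `Re (w q₀)` leaves room around `q₀`.
  let s : Set ℂ := {q | 0 < q.re ∧ m < (w * q).re ∧ ‖q‖ < B}
  have hs : s ∈ 𝓝 q₀ := by
    have : IsOpen s := by
      have hc : Continuous fun q : ℂ => (w * q).re := by fun_prop
      exact (isOpen_lt continuous_const Complex.continuous_re).inter
        ((isOpen_lt continuous_const hc).inter (isOpen_lt continuous_norm continuous_const))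
    refine this.mem_nhds ⟨hq, ?_, ?_⟩
    · rw [hm]; linarith
    · rw [hB]; linarith
  -- With `K` the kernel, this is at once the `q`-derivative of `q K(qr)` and the `r`-derivative of
  -- `r K(qr)`. Its integral over `r` is therefore a difference of boundary terms, both zero.
  let F' : ℂ → ℝ → ℂ := fun q r =>
    laplaceKernel α k w (q * r) * (1 - w * (q * r) - k * (α * (q * r) ^ (α : ℂ)))
  have hre : ∀ q : ℂ, ∀ r : ℝ, (q * r).re = q.re * r := fun q r => by simp
  have hwre : ∀ q : ℂ, ∀ r : ℝ, (w * (q * r)).re = (w * q).re * r := fun q r => by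
    rw [← mul_assoc, hre]
  have hker : ∀ q ∈ s, ∀ r : ℝ, 0 < r → ‖laplaceKernel α k w (q * r)‖ ≤ Real.exp (-(m * r)) := by
    intro q hq r hr
    refine (norm_laplaceKernel_le h0 h1 hk w (by rw [hre]; have := hq.1; positivity)).trans ?_
    rw [Real.exp_le_exp, hwre]
    have := hq.2.1
    nlinarith
  have hnorm : ∀ q ∈ s, ∀ r : ℝ, 0 < r → ‖q * r‖ ≤ B * r := by
    intro q hq r hr
    rw [norm_mul, Complex.norm_real, Real.norm_of_nonneg hr.le]
    exact mul_le_mul_of_nonneg_right hq.2.2.le hr.le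
  have hF'bound : ∀ q ∈ s, ∀ r : ℝ, 0 < r → ‖F' q r‖ ≤
      Real.exp (-(m * r)) * ((1 + k * α) + (‖w‖ * B + k * α * B) * r) := by
    intro q hq r hr
    rw [norm_mul]
    refine mul_le_mul (hker q hq r hr) ?_ (norm_nonneg _) (Real.exp_nonneg _)
    refine (norm_sub_le _ _).trans ((add_le_add (norm_sub_le _ _) le_rfl).trans ?_)
    rw [norm_one, norm_mul w, norm_mul (k : ℂ), norm_mul (α : ℂ), Complex.norm_real,
      Complex.norm_real, Real.norm_of_nonneg hk, Real.norm_of_nonneg h0.le]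
    have e1 := hnorm q hq r hr
    have e2 := mul_le_mul_of_nonneg_left e1 (norm_nonneg w)
    have e3 := mul_le_mul_of_nonneg_left ((norm_cpow_ofReal_le_one_add h0 h1 (q * r)).trans
      (add_le_add le_rfl e1)) (mul_nonneg hk h0.le)
    linarith
  have hmeasF : ∀ q : ℂ, AEStronglyMeasurable (fun r : ℝ => q * laplaceKernel α k w (q * r))
      (volume.restrict (Ioi 0)) := fun q =>
    (((measurable_laplaceKernel α k w).comp (by fun_prop)).const_mul q).aestronglyMeasurable
  have hderiv : ∀ q ∈ s, ∀ r : ℝ, 0 < r →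
      HasDerivAt (fun q : ℂ => q * laplaceKernel α k w (q * r)) (F' q r) q := by
    intro q hq r hr
    have hqr : 0 < (q * r).re := by rw [hre]; have := hq.1; positivity
    have hne : q * r ≠ 0 := fun h => by simp [h] at hqr
    have hd := (hasDerivAt_id q).mul ((hasDerivAt_laplaceKernel α k w hqr).comp q
      ((hasDerivAt_id q).mul_const (r : ℂ)))
    refine hd.congr_deriv ?_
    simp only [F', id, Function.comp, ← cpow_sub_one_mul_self (α := α) hne]
    ring
  have hq₀s : q₀ ∈ s := mem_of_mem_nhds hs
  have key := hasDerivAt_integral_of_dominated_loc_of_deriv_le (μ := volume.restrict (Ioi (0 : ℝ)))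
    (F := fun q r => q * laplaceKernel α k w (q * r)) (F' := F')
    (bound := fun r => Real.exp (-(m * r)) * ((1 + k * α) + (‖w‖ * B + k * α * B) * r))
    hs (Eventually.of_forall hmeasF) ?_ ?_ ?_ (integrableOn_affine_mul_exp_neg _ _ hm0) ?_
  · obtain ⟨hint, hd⟩ := key
    have hzero : ∫ r in Ioi (0 : ℝ), F' q₀ r = 0 := by
      have hb : ∀ r : ℝ, 0 ≤ r → ‖(r : ℂ) * laplaceKernel α k w (q₀ * r)‖ ≤
          r * Real.exp (-(m * r)) := by
        intro r hr
        rcases hr.eq_or_lt with rfl | hr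
        · simp
        rw [norm_mul, Complex.norm_real, Real.norm_of_nonneg hr.le]
        exact mul_le_mul_of_nonneg_left (hker q₀ hq₀s r hr) hr.le
      have := integral_Ioi_of_hasDerivAt_of_tendsto (a := (0 : ℝ))
        (f := fun r : ℝ => (r : ℂ) * laplaceKernel α k w (q₀ * r)) (f' := F' q₀) (m := 0)
        ?_ ?_ hint ?_
      · simpa using this
      · have hb0 : Tendsto (fun r : ℝ => r * Real.exp (-(m * r))) (𝓝[Ici 0] 0) (𝓝 0) := by
          have : Continuous fun r : ℝ => r * Real.exp (-(m * r)) := by fun_prop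
          simpa using (this.tendsto 0).mono_left nhdsWithin_le_nhds
        have := squeeze_zero_norm' ((eventually_mem_nhdsWithin (s := Ici (0 : ℝ))).mono
          fun r hr => hb r hr) hb0
        simpa [ContinuousWithinAt] using this
      · intro r hr
        have hqr : 0 < (q₀ * r).re := by rw [hre]; exact mul_pos hq hr
        have hne : q₀ * r ≠ 0 := fun h => by simp [h] at hqr
        have hlin : HasDerivAt (fun r : ℝ => q₀ * (r : ℂ)) q₀ r := by
          simpa using (Complex.ofRealCLM.hasDerivAt (x := r)).const_mul q₀
        have hd := (Complex.ofRealCLM.hasDerivAt (x := r)).mul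
          ((hasDerivAt_laplaceKernel α k w hqr).comp r hlin)
        refine hd.congr_deriv ?_
        simp only [F', Function.comp, ← cpow_sub_one_mul_self (α := α) hne,
          Complex.ofRealCLM_apply, Complex.ofReal_one]
        ring
      · refine squeeze_zero_norm' ((eventually_ge_atTop 0).mono fun r hr => hb r hr) ?_
        have := Real.tendsto_pow_mul_exp_neg_atTop_nhds_zero 1
        have h2 := (this.comp (tendsto_id.const_mul_atTop hm0)).const_mul m⁻¹
        refine (h2.congr fun r => ?_).trans (by simp)
        simp only [Function.comp, id, pow_one]
        field_simp
    rwa [hzero] at hd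
  · refine Integrable.mono' (integrableOn_affine_mul_exp_neg B 0 hm0) (hmeasF q₀) ?_
    refine (ae_restrict_iff' measurableSet_Ioi).2 (Eventually.of_forall fun r hr => ?_)
    rw [norm_mul, mul_comm, zero_mul, add_zero]
    exact mul_le_mul (hker q₀ hq₀s r hr) hq₀s.2.2.le (norm_nonneg _) (Real.exp_nonneg _)
  · have : Measurable (F' q₀) := by
      have := (measurable_laplaceKernel α k w).comp
        (show Measurable fun r : ℝ => q₀ * (r : ℂ) by fun_prop)
      exact this.mul (by fun_prop)
    exact this.aestronglyMeasurable
  · exact (ae_restrict_iff' measurableSet_Ioi).2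
      (Eventually.of_forall fun r hr q hq => hF'bound q hq r hr)
  · exact (ae_restrict_iff' measurableSet_Ioi).2
      (Eventually.of_forall fun r hr q hq => hderiv q hq r hr)

/-- Rotation of the contour of a Laplace integral from the negative imaginary to the positive real
axis. -/
lemma integral_laplaceKernel_rotate {α k : ℝ} (h0 : 0 < α) (h1 : α < 1) (hk : 0 ≤ k) {w : ℂ}
    (hre : 0 < w.re) (him : 0 < w.im) :
    ∫ r in Ioi (0 : ℝ), -Complex.I * laplaceKernel α k w (-Complex.I * r) =
      ∫ r in Ioi (0 : ℝ), laplaceKernel α k w r := by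
  let U : Set ℂ := {q | 0 < q.re} ∩ {q | 0 < (w * q).re}
  let J : ℂ → ℂ := fun q => ∫ r in Ioi (0 : ℝ), q * laplaceKernel α k w (q * r)
  have hUo : IsOpen U := by
    have hc : Continuous fun q : ℂ => (w * q).re := by fun_prop
    exact (isOpen_lt continuous_const Complex.continuous_re).inter (isOpen_lt continuous_const hc)
  have hUc : Convex ℝ U := by
    refine (convex_halfSpace_re_gt 0).inter ?_
    intro x hx y hy a b ha hb hab
    have e : (w * (a • x + b • y)).re = a * (w * x).re + b * (w * y).re := by
      simp only [Complex.real_smul, Complex.mul_re, Complex.add_re, Complex.add_im,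
        Complex.ofReal_re, Complex.ofReal_im, Complex.mul_im]
      ring
    simp only [mem_ofPred_eq] at hx hy ⊢
    rw [e]
    rcases ha.eq_or_lt with rfl | ha
    · have : b = 1 := by linarith
      subst this; simpa using hy
    · have := mul_pos ha hx
      have := mul_nonneg hb hy.le
      linarith
  -- The segment from `-i` to `1`. It lies in `U` for `t > 0`, but `-i` is on the boundary of `U`,
  -- so the value at `t = 0` is recovered by dominated convergence.
  let p : ℝ → ℂ := fun t => t + (1 - t) * -Complex.I
  have hpre : ∀ t, (p t).re = t := fun t => by simp [p]
  have hpw : ∀ t, (w * p t).re = t * w.re + (1 - t) * w.im := fun t => by simp [p]; ring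
  have hpU : ∀ t ∈ Ioc (0 : ℝ) 1, p t ∈ U := by
    intro t ht
    refine ⟨by simpa [hpre] using ht.1, ?_⟩
    rw [mem_ofPred_eq, hpw]
    have := mul_pos ht.1 hre
    have := mul_nonneg (sub_nonneg.2 ht.2) him.le
    linarith
  have hconst : ∀ t ∈ Ioc (0 : ℝ) 1, J (p t) = J (p 1) := by
    intro t ht
    refine hUo.is_const_of_deriv_eq_zero hUc.isPreconnected (fun q hq => ?_) (fun q hq => ?_)
      (hpU t ht) (hpU 1 ⟨one_pos, le_rfl⟩)
    · exact (hasDerivAt_rayIntegral h0 h1 hk hq.1 hq.2).differentiableAt.differentiableWithinAt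
    · exact (hasDerivAt_rayIntegral h0 h1 hk hq.1 hq.2).deriv
  have hpc : Continuous p := by fun_prop
  have hev : ∀ᶠ t in 𝓝[>] (0 : ℝ), t ∈ Ioc (0 : ℝ) 1 := Ioc_mem_nhdsGT one_pos
  have hlim : Tendsto (fun t => J (p t)) (𝓝[>] 0) (𝓝 (J (p 0))) := by
    -- `Re (w p(t))` is a convex combination of `w.re` and `w.im`, hence at least `m`. The factor
    -- `2` in the dominating function bounds `‖p t‖`.
    set m := min w.re w.im with hm
    have hm0 : 0 < m := lt_min hre him
    refine tendsto_integral_filter_of_dominated_convergence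
      (fun r => Real.exp (-(m * r)) * (2 + 0 * r)) ?_ ?_
      (integrableOn_affine_mul_exp_neg 2 0 hm0) ?_
    · refine Eventually.of_forall fun t => ?_
      exact (((measurable_laplaceKernel α k w).comp (by fun_prop)).const_mul _).aestronglyMeasurable
    · filter_upwards [hev] with t ht
      refine (ae_restrict_iff' measurableSet_Ioi).2 (Eventually.of_forall fun r hr => ?_)
      rw [norm_mul, zero_mul, add_zero, mul_comm]
      have hr : 0 < r := hr
      refine mul_le_mul ?_ ?_ (norm_nonneg _) (Real.exp_nonneg _)
      · refine (norm_laplaceKernel_le h0 h1 hk w ?_).trans ?_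
        · have := mul_pos ht.1 hr
          simpa [hpre] using this.le
        · rw [Real.exp_le_exp, ← mul_assoc, Complex.re_mul_ofReal, hpw, neg_le_neg_iff]
          refine mul_le_mul_of_nonneg_right ?_ hr.le
          have := mul_le_mul_of_nonneg_left (min_le_left w.re w.im) ht.1.le
          have := mul_le_mul_of_nonneg_left (min_le_right w.re w.im) (sub_nonneg.2 ht.2)
          linarith
      · refine (norm_add_le _ _).trans ?_
        rw [norm_mul, norm_neg, Complex.norm_I, mul_one, Complex.norm_real,
          Real.norm_of_nonneg ht.1.le, ← Complex.ofReal_one, ← Complex.ofReal_sub,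
          Complex.norm_real, Real.norm_of_nonneg (sub_nonneg.2 ht.2)]
        linarith
    · refine (ae_restrict_iff' measurableSet_Ioi).2 (Eventually.of_forall fun r hr => ?_)
      have hr : 0 < r := hr
      have hmem : p 0 * r ∈ Complex.slitPlane := by
        refine Or.inr ?_
        simp [p, hr.ne']
      have hc := ((continuousOn_laplaceKernel α k w).continuousAt
        (Complex.isOpen_slitPlane.mem_nhds hmem))
      have hc2 : ContinuousAt (fun t => p t * r) 0 := by fun_prop
      have hc3 : ContinuousAt (fun t => p t * laplaceKernel α k w (p t * r)) 0 :=
        hpc.continuousAt.mul (ContinuousAt.comp (f := fun t => p t * r) hc hc2)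
      exact hc3.tendsto.mono_left nhdsWithin_le_nhds
  have h := tendsto_nhds_unique hlim
    (tendsto_const_nhds.congr' (hev.mono fun t ht => (hconst t ht).symm))
  simpa [J, p] using h

/-! ### The stable law has no mass on the negative half line -/

lemma cos_half_pi_mul_pos {α : ℝ} (h0 : 0 < α) (h1 : α < 1) : 0 < Real.cos (Real.pi * α / 2) := by
  have := Real.pi_pos
  refine Real.cos_pos_of_mem_Ioo ⟨?_, ?_⟩ <;> nlinarith

/-- The characteristic function of a maximally skewed stable law, in holomorphic form. -/
lemma IsMaxSkewedStable.charFun_eq_exp_cpow {α : ℝ} {μ : Measure ℝ} (h0 : 0 < α) (h1 : α < 1)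
    (h : IsMaxSkewedStable α μ) (l : ℝ) :
    charFun μ l = Complex.exp
      (-(((Real.cos (Real.pi * α / 2))⁻¹ : ℝ) * (-Complex.I * l) ^ (α : ℂ))) := by
  have hc := cos_half_pi_mul_pos h0 h1
  rw [h.charFun_eq]
  congr 1
  rw [neg_mul]
  congr 1
  apply Complex.ext
  · rw [Complex.re_ofReal_mul, Complex.re_ofReal_mul, Complex.cpow_ofReal_re]
    rcases lt_trichotomy l 0 with hl | rfl | hl
    · have : Complex.arg (-Complex.I * l) = Real.pi / 2 := by
        rw [show -Complex.I * (l : ℂ) = ((-l : ℝ) : ℂ) * Complex.I by push_cast; ring,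
          Complex.arg_real_mul _ (by linarith), Complex.arg_I]
      rw [this]
      simp only [norm_mul, norm_neg, Complex.norm_I, Complex.norm_real, Real.norm_eq_abs]
      rw [show Real.pi / 2 * α = Real.pi * α / 2 by ring]
      simp [-Complex.ofReal_tan]
      field_simp
    · simp [Real.zero_rpow h0.ne']
    · have : Complex.arg (-Complex.I * l) = -(Real.pi / 2) := by
        rw [mul_comm, Complex.arg_real_mul _ hl, Complex.arg_neg_I]
      rw [this]
      simp only [norm_mul, norm_neg, Complex.norm_I, Complex.norm_real, Real.norm_eq_abs]
      rw [show -(Real.pi / 2) * α = -(Real.pi * α / 2) by ring, Real.cos_neg]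
      simp [-Complex.ofReal_tan]
      field_simp
  · rw [Complex.im_ofReal_mul, Complex.im_ofReal_mul, Complex.cpow_ofReal_im]
    rcases lt_trichotomy l 0 with hl | rfl | hl
    · have : Complex.arg (-Complex.I * l) = Real.pi / 2 := by
        rw [show -Complex.I * (l : ℂ) = ((-l : ℝ) : ℂ) * Complex.I by push_cast; ring,
          Complex.arg_real_mul _ (by linarith), Complex.arg_I]
      rw [this, Real.sign_of_neg hl]
      simp only [norm_mul, norm_neg, Complex.norm_I, Complex.norm_real, Real.norm_eq_abs]
      rw [show Real.pi / 2 * α = Real.pi * α / 2 by ring, Real.tan_eq_sin_div_cos]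
      simp [-Complex.ofReal_sin, -Complex.ofReal_cos, -Complex.ofReal_div]
      field_simp
    · simp [Real.zero_rpow h0.ne']
    · have : Complex.arg (-Complex.I * l) = -(Real.pi / 2) := by
        rw [mul_comm, Complex.arg_real_mul _ hl, Complex.arg_neg_I]
      rw [this, Real.sign_of_pos hl]
      simp only [norm_mul, norm_neg, Complex.norm_I, Complex.norm_real, Real.norm_eq_abs]
      rw [show -(Real.pi / 2) * α = -(Real.pi * α / 2) by ring, Real.sin_neg,
        Real.tan_eq_sin_div_cos]
      simp [-Complex.ofReal_sin, -Complex.ofReal_cos, -Complex.ofReal_div]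
      field_simp

/-- The Cauchy transform of a finite measure as a half-line transform of its characteristic
function. -/
lemma integral_inv_add_eq_integral_charFun (μ : Measure ℝ) [IsFiniteMeasure μ] {w : ℂ}
    (hw : 0 < w.im) :
    ∫ x : ℝ, (w + x)⁻¹ ∂μ =
      ∫ r in Ioi (0 : ℝ), -Complex.I * (Complex.exp (Complex.I * w * r) * charFun μ r) := by
  have e : ∀ r x : ℝ, -Complex.I * (Complex.exp (Complex.I * w * r) * Complex.exp (r * x * Complex.I))
      = -Complex.I * Complex.exp (Complex.I * (w + x) * r) := fun r x => by
    rw [← Complex.exp_add]; ring_nf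
  simp_rw [charFun_apply_real, ← integral_const_mul, e]
  rw [integral_integral_swap]
  · refine integral_congr_ae (Eventually.of_forall fun x => ?_)
    have hre : (Complex.I * (w + x)).re < 0 := by simpa using hw
    have hne : w + x ≠ 0 := fun h => by simp [h] at hre
    simp only
    rw [integral_const_mul, integral_exp_mul_complex_Ioi hre]
    field_simp
    simp
  · have hi : Integrable (fun z : ℝ × ℝ => Real.exp (-w.im * z.1) * 1)
        ((volume.restrict (Ioi 0)).prod μ) :=
      (integrableOn_exp_mul_Ioi (by linarith : -w.im < 0) 0).mul_prod (integrable_const (1 : ℝ))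
    refine hi.mono' (by fun_prop) (Eventually.of_forall fun z => ?_)
    simp [Function.uncurry, Complex.norm_exp]

lemma integrable_inv_add (μ : Measure ℝ) [IsFiniteMeasure μ] {w : ℂ} (hw : 0 < w.im) :
    Integrable (fun x : ℝ => (w + x)⁻¹) μ := by
  refine Integrable.of_bound (C := w.im⁻¹) (by fun_prop) (Eventually.of_forall fun x => ?_)
  rw [norm_inv]
  refine inv_anti₀ hw ?_
  simpa using (le_abs_self _).trans (Complex.abs_im_le_norm (w + x))

lemma im_inv_add_eq (w : ℂ) (x : ℝ) :
    ((w + x)⁻¹).im = -(w.im / ((x + w.re) ^ 2 + w.im ^ 2)) := by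
  rw [Complex.inv_im, Complex.normSq_apply]
  simp
  ring

/-- The Poisson integral of a maximally skewed stable law is small on the negative half line. -/
lemma IsMaxSkewedStable.integral_poisson_le {α : ℝ} {μ : Measure ℝ} (h0 : 0 < α) (h1 : α < 1)
    (h : IsMaxSkewedStable α μ) {y η : ℝ} (hy : 0 < y) (hη : 0 < η) :
    ∫ x : ℝ, η / ((x + y) ^ 2 + η ^ 2) ∂μ ≤ η / y ^ 2 := by
  have := h.isProbabilityMeasure
  set k := (Real.cos (Real.pi * α / 2))⁻¹ with hk
  have hk0 : 0 < k := inv_pos.2 (cos_half_pi_mul_pos h0 h1)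
  set w : ℂ := ⟨y, η⟩ with hw
  -- After rotation the integrand is `exp (-w r - k r^α)` with `r` real, so the imaginary part comes
  -- only from `sin (η r)`, which is of order `η`.
  have e1 : ∫ x : ℝ, (w + x)⁻¹ ∂μ = ∫ r in Ioi (0 : ℝ), laplaceKernel α k w r := by
    rw [integral_inv_add_eq_integral_charFun μ (w := w) hη,
      ← integral_laplaceKernel_rotate h0 h1 hk0.le (w := w) hy hη]
    refine integral_congr_ae (Eventually.of_forall fun r => ?_)
    simp only [laplaceKernel]
    rw [h.charFun_eq_exp_cpow h0 h1]
    congr 3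
    ring
  have e2 : ∫ x : ℝ, η / ((x + y) ^ 2 + η ^ 2) ∂μ = -(∫ x : ℝ, (w + x)⁻¹ ∂μ).im := by
    have := integral_im (integrable_inv_add μ (w := w) hη)
    simp only [RCLike.im_to_complex] at this
    rw [← this, ← integral_neg]
    refine integral_congr_ae (Eventually.of_forall fun x => ?_)
    simp only
    rw [im_inv_add_eq, neg_neg]
  -- The exponent is written `2 - 1` to match the Gamma integral `∫ r^(2-1) e^{-yr} = Γ(2) / y²`.
  have hint : IntegrableOn (fun r : ℝ => η * (r ^ ((2 : ℝ) - 1) * Real.exp (-(y * r)))) (Ioi 0) := by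
    have := (integrableOn_affine_mul_exp_neg 0 1 hy).const_mul η
    refine this.congr (Eventually.of_forall fun r => ?_)
    simp only
    rw [show (2 : ℝ) - 1 = 1 by norm_num, Real.rpow_one]
    ring
  have hmono : ∀ r : ℝ, 0 < r → -(laplaceKernel α k w r).im ≤
      η * (r ^ ((2 : ℝ) - 1) * Real.exp (-(y * r))) := by
    intro r hr
    rw [show (2 : ℝ) - 1 = 1 by norm_num, Real.rpow_one, laplaceKernel,
      ← Complex.ofReal_cpow hr.le, ← Complex.ofReal_mul, ← Complex.ofReal_neg,
      ← Complex.ofReal_exp, Complex.im_mul_ofReal, Complex.exp_im]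
    simp only [Complex.neg_re, Complex.neg_im, Complex.re_mul_ofReal, Complex.im_mul_ofReal,
      Real.sin_neg, hw]
    have h1 : Real.exp (-(k * r ^ α)) ≤ 1 := by
      rw [Real.exp_le_one_iff]
      have := Real.rpow_nonneg hr.le α
      nlinarith
    have h2 : |Real.sin (η * r)| ≤ η * r := by
      have := Real.abs_sin_le_abs (x := η * r)
      rwa [abs_of_pos (mul_pos hη hr)] at this
    calc _ = Real.exp (-(y * r)) * (Real.sin (η * r) * Real.exp (-(k * r ^ α))) := by ring
      _ ≤ Real.exp (-(y * r)) * (η * r * 1) := by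
        refine mul_le_mul_of_nonneg_left ?_ (Real.exp_nonneg _)
        exact (mul_le_mul_of_nonneg_right ((le_abs_self _).trans h2) (Real.exp_nonneg _)).trans
          (mul_le_mul_of_nonneg_left h1 (by positivity))
      _ = _ := by ring
  have hint2 : IntegrableOn (fun r : ℝ => laplaceKernel α k w r) (Ioi 0) := by
    refine Integrable.mono' (integrableOn_affine_mul_exp_neg 1 0 hy)
      ((measurable_laplaceKernel α k w).comp (by fun_prop)).aestronglyMeasurable ?_
    refine (ae_restrict_iff' measurableSet_Ioi).2 (Eventually.of_forall fun r hr => ?_)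
    have hr : (0 : ℝ) < r := hr
    refine (norm_laplaceKernel_le h0 h1 hk0.le w (by simpa using hr.le)).trans ?_
    simp [hw]
  rw [e2, e1]
  have e3 := integral_im hint2
  simp only [RCLike.im_to_complex] at e3
  rw [← e3, ← integral_neg]
  refine (setIntegral_mono_on hint2.im.neg hint measurableSet_Ioi
    fun r hr => hmono r hr).trans_eq ?_
  rw [integral_const_mul, Real.integral_rpow_mul_exp_neg_mul_Ioi (by norm_num) hy]
  rw [show (2 : ℝ) = (1 : ℕ) + 1 by norm_num, Real.Gamma_nat_eq_factorial]
  norm_num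
  rw [div_eq_mul_inv]

/-- If the mass of every short interval around every negative point is quadratically small, then
the negative half line is null. -/
lemma measure_Iio_zero_eq_zero_of_quadratic (μ : Measure ℝ) [IsProbabilityMeasure μ] (C : ℝ → ℝ)
    (hC : ∀ y < 0, ∀ h > 0, μ.real (Icc (y - h) (y + h)) ≤ C y * h ^ 2) : μ (Iio 0) = 0 := by
  have hdist : ∀ y < 0, ∀ x, ‖cdf μ x - cdf μ y‖ ≤ C y * ‖‖x - y‖ ^ 2‖ := by
    intro y hy x
    rcases eq_or_ne x y with rfl | hne
    · simp
    have hpos : 0 < ‖x - y‖ := norm_pos_iff.2 (sub_ne_zero.2 hne)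
    rw [Real.norm_of_nonneg (by positivity : 0 ≤ ‖x - y‖ ^ 2)]
    refine le_trans ?_ (hC y hy _ hpos)
    rw [cdf_eq_real, cdf_eq_real]
    have key : ∀ a b : ℝ, a ≤ b → ‖μ.real (Iic b) - μ.real (Iic a)‖ ≤ μ.real (Icc a b) := by
      intro a b hab
      rw [← measureReal_sdiff (Iic_subset_Iic.2 hab) measurableSet_Iic,
        Real.norm_of_nonneg measureReal_nonneg]
      refine measureReal_mono ?_
      rintro z ⟨hz1, hz2⟩
      exact ⟨(not_le.1 hz2).le, hz1⟩
    rcases le_total x y with hxy | hxy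
    · rw [norm_sub_rev]
      refine (key _ _ hxy).trans (measureReal_mono (Icc_subset_Icc ?_ ?_))
      · rw [Real.norm_eq_abs, abs_of_nonpos (by linarith)]; linarith
      · linarith
    · refine (key _ _ hxy).trans (measureReal_mono (Icc_subset_Icc ?_ ?_))
      · linarith
      · rw [Real.norm_eq_abs, abs_of_nonneg (by linarith)]; linarith
  -- Increments of quadratic size force derivative zero, so the distribution function is constant on
  -- the negative half line, equal to its limit `0` at `-∞`.
  have hderiv : ∀ y < 0, HasDerivAt (cdf μ) 0 y := by
    intro y hy
    have hO : (fun x => cdf μ x - cdf μ y) =O[𝓝 y] fun x => ‖x - y‖ ^ 2 :=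
      Asymptotics.IsBigO.of_bound (C y) (Eventually.of_forall (hdist y hy))
    have := (hO.hasFDerivAt (𝕜 := ℝ) (by norm_num)).hasDerivAt.add_const (cdf μ y)
    simpa using this
  have hconst : ∀ y < 0, cdf μ y = 0 := by
    intro y hy
    have hc : ∀ x ∈ Iio (0 : ℝ), cdf μ x = cdf μ y := fun x hx =>
      isOpen_Iio.is_const_of_deriv_eq_zero isPreconnected_Iio
        (fun z hz => (hderiv z hz).differentiableAt.differentiableWithinAt)
        (fun z hz => (hderiv z hz).deriv) hx hy
    exact tendsto_nhds_unique
      (tendsto_const_nhds.congr' ((eventually_lt_atBot 0).mono fun x hx => (hc x hx).symm))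
      (tendsto_cdf_atBot μ)
  have hU : Iio (0 : ℝ) ⊆ ⋃ n : ℕ, Iic (-(1 / ((n : ℝ) + 1))) := by
    intro x hx
    obtain ⟨n, hn⟩ := exists_nat_one_div_lt (neg_pos.2 (mem_Iio.1 hx))
    exact mem_iUnion.2 ⟨n, by simp only [mem_Iic]; linarith⟩
  refine measure_mono_null hU (measure_iUnion_null fun n => ?_)
  rw [← ofReal_cdf, hconst _ (by simp; positivity), ENNReal.ofReal_zero]

/-- On an interval of radius `η` the Poisson kernel of width `η` is at least `1/(2η)`, so a Poisson
integral of size `η / y²` leaves mass at most `2η² / y²` there: the quadratic smallness required. -/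
lemma IsMaxSkewedStable.measure_Iio_zero {α : ℝ} {μ : Measure ℝ} (h0 : 0 < α) (h1 : α < 1)
    (h : IsMaxSkewedStable α μ) : μ (Iio 0) = 0 := by
  have := h.isProbabilityMeasure
  refine measure_Iio_zero_eq_zero_of_quadratic μ (fun y => 2 / y ^ 2) fun y hy η hη => ?_
  have hb := h.integral_poisson_le h0 h1 (neg_pos.2 hy) hη
  have hint : Integrable (fun x : ℝ => η / ((x + -y) ^ 2 + η ^ 2)) μ := by
    have := (integrable_inv_add μ (w := ⟨-y, η⟩) hη).im.neg
    refine this.congr (Eventually.of_forall fun x => ?_)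
    simp only [Pi.neg_apply, RCLike.im_to_complex]
    rw [im_inv_add_eq, neg_neg]
  have hle : ∫ x, (Icc (y - η) (y + η)).indicator (fun _ => 1 / (2 * η)) x ∂μ ≤
      ∫ x : ℝ, η / ((x + -y) ^ 2 + η ^ 2) ∂μ := by
    refine integral_mono ((integrable_const _).indicator measurableSet_Icc) hint fun x => ?_
    by_cases hx : x ∈ Icc (y - η) (y + η)
    · rw [indicator_of_mem hx, div_le_div_iff₀ (by positivity) (by positivity)]
      nlinarith [hx.1, hx.2]
    · rw [indicator_of_notMem hx]
      positivity
  rw [integral_indicator_const _ measurableSet_Icc, smul_eq_mul] at hle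
  have h3 := hle.trans hb
  have hy2 : 0 < y ^ 2 := by nlinarith
  rw [neg_sq] at h3
  calc μ.real (Icc (y - η) (y + η))
      = (μ.real (Icc (y - η) (y + η)) * (1 / (2 * η))) * (2 * η) := by field_simp
    _ ≤ η / y ^ 2 * (2 * η) := mul_le_mul_of_nonneg_right h3 (by positivity)
    _ = 2 / y ^ 2 * η ^ 2 := by ring

lemma ae_nonneg_of_measure_Iio {μ : Measure ℝ} (hμ : μ (Iio 0) = 0) : ∀ᵐ x ∂μ, 0 ≤ x := by
  rw [ae_iff]
  simpa [Iio, not_le] using hμ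

/-! ### The Laplace transform and strict positivity -/

section NonnegLaw

variable {μ : Measure ℝ} [IsFiniteMeasure μ]

lemma Ioi_subset_interior_integrableExpSet_neg (hμ : μ (Iio 0) = 0) :
    Ioi 0 ⊆ interior (integrableExpSet (fun x : ℝ => -x) μ) := by
  refine interior_maximal (fun t ht => ?_) isOpen_Ioi
  refine Integrable.of_bound (C := 1) (by fun_prop) ?_
  filter_upwards [ae_nonneg_of_measure_Iio hμ] with x hx
  rw [Real.norm_of_nonneg (Real.exp_nonneg _), Real.exp_le_one_iff]
  have := mul_nonneg (mem_Ioi.1 ht).le hx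
  linarith

lemma diffContOnCl_complexMGF_neg (hμ : μ (Iio 0) = 0) :
    DiffContOnCl ℂ (complexMGF (fun x : ℝ => -x) μ) {z | 0 < z.re} := by
  refine ⟨differentiableOn_complexMGF.mono fun z hz =>
    Ioi_subset_interior_integrableExpSet_neg hμ hz, ?_⟩
  rw [Complex.closure_setOfPred_lt_re]
  refine continuousOn_of_dominated (bound := fun _ => 1) (fun z _ => by fun_prop) ?_
    (integrable_const _) (Eventually.of_forall fun x => by fun_prop)
  intro z hz
  filter_upwards [ae_nonneg_of_measure_Iio hμ] with x hx
  rw [Complex.norm_exp, Real.exp_le_one_iff]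
  have := mul_nonneg (show 0 ≤ z.re from hz) hx
  simpa using this

lemma norm_complexMGF_neg_le (hμ : μ (Iio 0) = 0) {z : ℂ} (hz : 0 ≤ z.re) :
    ‖complexMGF (fun x : ℝ => -x) μ z‖ ≤ μ.real univ := by
  refine (norm_integral_le_of_norm_le_const (C := 1) ?_).trans (by simp)
  filter_upwards [ae_nonneg_of_measure_Iio hμ] with x hx
  rw [Complex.norm_exp, Real.exp_le_one_iff]
  have := mul_nonneg hz hx
  simpa using this

end NonnegLaw

lemma continuousOn_cpow_const_re_nonneg {α : ℝ} (h0 : 0 < α) :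
    ContinuousOn (fun z : ℂ => z ^ (α : ℂ)) {z | 0 ≤ z.re} := by
  intro z hz
  have := Complex.continuousAt_cpow_of_re_pos (p := (z, (α : ℂ))) (Or.inl hz) (by simpa using h0)
  exact (ContinuousAt.comp (f := fun z : ℂ => (z, (α : ℂ))) this
    (by fun_prop)).continuousWithinAt

/-- The Laplace transform of a maximally skewed stable law. -/
lemma IsMaxSkewedStable.complexMGF_neg {α : ℝ} {μ : Measure ℝ} (h0 : 0 < α) (h1 : α < 1)
    (h : IsMaxSkewedStable α μ) {z : ℂ} (hz : 0 ≤ z.re) :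
    complexMGF (fun x : ℝ => -x) μ z =
      Complex.exp (-(((Real.cos (Real.pi * α / 2))⁻¹ : ℝ) * z ^ (α : ℂ))) := by
  have := h.isProbabilityMeasure
  have hμ := h.measure_Iio_zero h0 h1
  set k := (Real.cos (Real.pi * α / 2))⁻¹ with hk
  have hk0 : 0 < k := inv_pos.2 (cos_half_pi_mul_pos h0 h1)
  set D : ℂ → ℂ := fun z => complexMGF (fun x : ℝ => -x) μ z - Complex.exp (-(k * z ^ (α : ℂ)))
    with hD
  have hbound : ∀ z : ℂ, 0 ≤ z.re → ‖D z‖ ≤ 2 := by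
    intro z hz
    have e1 := norm_complexMGF_neg_le hμ hz
    have e2 := norm_exp_neg_cpow_le_one h0 h1 hk0.le hz
    rw [probReal_univ] at e1
    exact (norm_sub_le _ _).trans (by linarith)
  have hdc : DiffContOnCl ℂ D {z | 0 < z.re} := by
    refine (diffContOnCl_complexMGF_neg hμ).sub ⟨fun z hz => ?_, ?_⟩
    · refine DifferentiableAt.differentiableWithinAt ?_
      exact (((differentiableAt_id.cpow_const (Or.inl hz)).const_mul _).neg).cexp
    · rw [Complex.closure_setOfPred_lt_re]
      exact ((continuousOn_const.mul (continuousOn_cpow_const_re_nonneg h0)).neg).cexp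
  -- Phragmén–Lindelöf in the right half plane: `D` is bounded, so growth exponent `0 < 2` suffices,
  -- and it vanishes on the imaginary axis, where the transform is the characteristic function. The
  -- resulting bound is `0`.
  have hzero : ‖D z‖ ≤ 0 := by
    refine PhragmenLindelof.right_half_plane_of_bounded_on_real hdc ⟨0, two_pos, 0, ?_⟩ ?_ ?_ hz
    · refine Asymptotics.IsBigO.of_bound 2 ?_
      refine eventually_inf_principal.2 (Eventually.of_forall fun z hz => ?_)
      simpa using hbound z (le_of_lt hz)
    · refine isBoundedUnder_of_eventually_le (a := 2) ?_
      filter_upwards [eventually_ge_atTop 0] with x hx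
      exact hbound x (by simpa using hx)
    · intro x
      refine le_of_eq ?_
      rw [norm_eq_zero, hD]
      simp only
      rw [sub_eq_zero]
      have e1 : complexMGF (fun x : ℝ => -x) μ (x * Complex.I) = charFun μ (-x) := by
        rw [charFun_apply_real, complexMGF]
        refine integral_congr_ae (Eventually.of_forall fun y => ?_)
        simp only
        congr 1
        push_cast
        ring
      rw [e1, h.charFun_eq_exp_cpow h0 h1]
      congr 4
      push_cast
      ring
  exact sub_eq_zero.1 (norm_le_zero_iff.1 hzero)

lemma IsMaxSkewedStable.mgf_neg {α : ℝ} {μ : Measure ℝ} (h0 : 0 < α) (h1 : α < 1)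
    (h : IsMaxSkewedStable α μ) {u : ℝ} (hu : 0 ≤ u) :
    mgf (fun x : ℝ => -x) μ u = Real.exp (-((Real.cos (Real.pi * α / 2))⁻¹ * u ^ α)) := by
  have e := h.complexMGF_neg h0 h1 (z := u) (by simpa using hu)
  rw [complexMGF_ofReal, ← Complex.ofReal_cpow hu] at e
  exact_mod_cast e

/-- Chernoff: the indicator of `x ≤ 0` is at most `exp (-u x)`, whose mean `exp (-k u^α)` tends to
`0` as `u → ∞`. -/
lemma IsMaxSkewedStable.measure_Iic_zero {α : ℝ} {μ : Measure ℝ} (h0 : 0 < α) (h1 : α < 1)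
    (h : IsMaxSkewedStable α μ) : μ (Iic 0) = 0 := by
  have := h.isProbabilityMeasure
  have hμ := h.measure_Iio_zero h0 h1
  set k := (Real.cos (Real.pi * α / 2))⁻¹ with hk
  have hk0 : 0 < k := inv_pos.2 (cos_half_pi_mul_pos h0 h1)
  have hle : ∀ u : ℝ, 0 < u → μ.real (Iic 0) ≤ Real.exp (-(k * u ^ α)) := by
    intro u hu
    rw [← h.mgf_neg h0 h1 hu.le, mgf, ← one_mul (μ.real _), mul_comm, ← smul_eq_mul,
      ← integral_indicator_const _ measurableSet_Iic]
    have hi : u ∈ integrableExpSet (fun x : ℝ => -x) μ :=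
      interior_subset (Ioi_subset_interior_integrableExpSet_neg hμ (mem_Ioi.2 hu))
    refine integral_mono ((integrable_const _).indicator measurableSet_Iic) hi fun x => ?_
    by_cases hx : x ∈ Iic (0 : ℝ)
    · rw [indicator_of_mem hx]
      have := mul_nonneg hu.le (neg_nonneg.2 (mem_Iic.1 hx))
      exact Real.one_le_exp this
    · rw [indicator_of_notMem hx]
      exact Real.exp_nonneg _
  have hlim : Tendsto (fun u : ℝ => Real.exp (-(k * u ^ α))) atTop (𝓝 0) :=
    Real.tendsto_exp_neg_atTop_nhds_zero.comp ((tendsto_rpow_atTop h0).const_mul_atTop hk0)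
  have h3 := ge_of_tendsto hlim ((eventually_gt_atTop 0).mono hle)
  exact (measureReal_eq_zero_iff).1 (le_antisymm h3 measureReal_nonneg)

lemma IsMaxSkewedStable.ae_pos {α : ℝ} {μ : Measure ℝ} (h0 : 0 < α) (h1 : α < 1)
    (h : IsMaxSkewedStable α μ) : ∀ᵐ x ∂μ, 0 < x := by
  rw [ae_iff]
  simpa [Iic, not_lt] using h.measure_Iic_zero h0 h1

/-- The derivative of the Laplace transform. -/
lemma IsMaxSkewedStable.integral_mul_exp_neg {α : ℝ} {μ : Measure ℝ} (h0 : 0 < α) (h1 : α < 1)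
    (h : IsMaxSkewedStable α μ) {u : ℝ} (hu : 0 < u) :
    ∫ x, x * Real.exp (-(u * x)) ∂μ = (Real.cos (Real.pi * α / 2))⁻¹ * α * u ^ (α - 1) *
      Real.exp (-((Real.cos (Real.pi * α / 2))⁻¹ * u ^ α)) := by
  have := h.isProbabilityMeasure
  have hμ := h.measure_Iio_zero h0 h1
  set k := (Real.cos (Real.pi * α / 2))⁻¹ with hk
  have d1 := hasDerivAt_mgf (Ioi_subset_interior_integrableExpSet_neg hμ (mem_Ioi.2 hu))
  have d2 : HasDerivAt (fun u : ℝ => Real.exp (-(k * u ^ α)))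
      (Real.exp (-(k * u ^ α)) * -(k * (α * u ^ (α - 1)))) u :=
    (((Real.hasDerivAt_rpow_const (Or.inl hu.ne')).const_mul k).neg).exp
  have hev : (fun u : ℝ => Real.exp (-(k * u ^ α))) =ᶠ[𝓝 u] mgf (fun x : ℝ => -x) μ :=
    (eventually_gt_nhds hu).mono fun v hv => (h.mgf_neg h0 h1 hv.le).symm
  have e := d1.unique (d2.congr_of_eventuallyEq hev.symm)
  have e2 : ∫ x, x * Real.exp (-(u * x)) ∂μ = -∫ x, -x * Real.exp (u * -x) ∂μ := by
    rw [← integral_neg]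
    refine integral_congr_ae (Eventually.of_forall fun x => ?_)
    simp only [mul_neg, neg_mul, neg_neg]
  rw [e2, e]
  ring

/-! ### The Stieltjes transform of the ratio -/

/-- The law of the ratio `S₂ / S₁` of two independent variables of law `μ`. -/
noncomputable def ratioLaw (μ : Measure ℝ) : Measure ℝ :=
  (μ.prod μ).map fun S : ℝ × ℝ => S.2 / S.1

lemma measurable_ratio : Measurable fun S : ℝ × ℝ => S.2 / S.1 := by fun_prop

lemma isProbabilityMeasure_ratioLaw (μ : Measure ℝ) [IsProbabilityMeasure μ] :
    IsProbabilityMeasure (ratioLaw μ) :=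
  Measure.isProbabilityMeasure_map measurable_ratio.aemeasurable

lemma ae_prod_pos {μ : Measure ℝ} [SFinite μ] (h : ∀ᵐ x ∂μ, 0 < x) :
    ∀ᵐ S ∂(μ.prod μ), 0 < S.1 ∧ 0 < S.2 := by
  have e1 := Measure.quasiMeasurePreserving_fst (μ := μ) (ν := μ) |>.ae h
  have e2 := Measure.quasiMeasurePreserving_snd (μ := μ) (ν := μ) |>.ae h
  exact e1.and e2

lemma ae_ratioLaw_pos {μ : Measure ℝ} [SFinite μ] (h : ∀ᵐ x ∂μ, 0 < x) :
    ∀ᵐ x ∂(ratioLaw μ), 0 < x := by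
  refine (ae_map_iff measurable_ratio.aemeasurable measurableSet_Ioi).2 ?_
  filter_upwards [ae_prod_pos h] with S hS
  exact div_pos hS.2 hS.1

/-- The Stieltjes transform of the ratio of two independent maximally skewed stable variables. -/
lemma IsMaxSkewedStable.integral_ratioLaw_inv_add {α : ℝ} {μ : Measure ℝ} (h0 : 0 < α)
    (h1 : α < 1) (h : IsMaxSkewedStable α μ) {w : ℝ} (hw : 0 < w) :
    ∫ x, (w + x)⁻¹ ∂(ratioLaw μ) = w ^ (α - 1) / (1 + w ^ α) := by
  have := h.isProbabilityMeasure
  set k := (Real.cos (Real.pi * α / 2))⁻¹ with hk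
  have hk0 : 0 < k := inv_pos.2 (cos_half_pi_mul_pos h0 h1)
  have hpos := ae_prod_pos (h.ae_pos h0 h1)
  -- Writing `(w + S₂/S₁)⁻¹` as `∫ S₁ e^{-(w S₁ + S₂)u} du` removes the quotient and separates the
  -- two variables; the mean is then a product of the Laplace transform and minus its derivative.
  let f : ℝ → ℝ × ℝ → ℝ := fun u S => S.1 * Real.exp (-(w * S.1 + S.2) * u)
  have hinner : ∀ S : ℝ × ℝ, 0 < S.1 ∧ 0 < S.2 →
      ∫ u in Ioi (0 : ℝ), f u S = (w + S.2 / S.1)⁻¹ := by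
    intro S hS
    obtain ⟨hS1, hS2⟩ := hS
    have hneg : -(w * S.1 + S.2) < 0 := by have := mul_pos hw hS1; linarith
    simp only [f]
    rw [integral_const_mul, integral_exp_mul_Ioi hneg]
    have : w * S.1 + S.2 ≠ 0 := by linarith
    rw [mul_zero, Real.exp_zero]
    field_simp
  have hint : Integrable (Function.uncurry f) ((volume.restrict (Ioi 0)).prod (μ.prod μ)) := by
    have hm : Measurable (Function.uncurry f) := by
      simp only [f, Function.uncurry_def]
      fun_prop
    refine (integrable_prod_iff' hm.aestronglyMeasurable).2 ⟨?_, ?_⟩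
    · filter_upwards [hpos] with S hS
      have hneg : -(w * S.1 + S.2) < 0 := by have := mul_pos hw hS.1; linarith [hS.2]
      exact (integrableOn_exp_mul_Ioi hneg 0).const_mul S.1
    · refine Integrable.of_bound (C := w⁻¹) hm.norm.stronglyMeasurable.integral_prod_left'.aestronglyMeasurable ?_
      filter_upwards [hpos] with S hS
      have e : ∫ u in Ioi (0 : ℝ), ‖Function.uncurry f (u, S)‖ = (w + S.2 / S.1)⁻¹ := by
        rw [← hinner S hS]
        refine integral_congr_ae (Eventually.of_forall fun u => ?_)
        exact Real.norm_of_nonneg (mul_nonneg hS.1.le (Real.exp_nonneg _))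
      have hd := div_pos hS.2 hS.1
      rw [e, Real.norm_of_nonneg (by positivity)]
      exact inv_anti₀ hw (by linarith)
  have e1 : ∫ x, (w + x)⁻¹ ∂(ratioLaw μ) = ∫ S, (∫ u in Ioi (0 : ℝ), f u S) ∂(μ.prod μ) := by
    rw [ratioLaw, integral_map measurable_ratio.aemeasurable (by fun_prop)]
    refine integral_congr_ae ?_
    filter_upwards [hpos] with S hS
    exact (hinner S hS).symm
  rw [e1, ← integral_integral_swap hint]
  have e2 : ∀ u ∈ Ioi (0 : ℝ), ∫ S, f u S ∂(μ.prod μ) =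
      k * α * w ^ (α - 1) * (u ^ (α - 1) * Real.exp (-(k * (1 + w ^ α)) * u ^ α)) := by
    intro u hu
    have hu : 0 < u := hu
    have e3 : ∀ S : ℝ × ℝ, f u S =
        (S.1 * Real.exp (-(u * w * S.1))) * Real.exp (u * -S.2) := by
      intro S
      simp only [f]
      rw [mul_assoc, ← Real.exp_add]
      ring_nf
    simp_rw [e3]
    rw [integral_prod_mul (fun x : ℝ => x * Real.exp (-(u * w * x)))
      (fun y : ℝ => Real.exp (u * -y)), h.integral_mul_exp_neg h0 h1 (mul_pos hu hw)]
    have e4 : ∫ y : ℝ, Real.exp (u * -y) ∂μ = Real.exp (-(k * u ^ α)) := h.mgf_neg h0 h1 hu.le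
    rw [e4, Real.mul_rpow hu.le hw.le, Real.mul_rpow hu.le hw.le, mul_assoc, ← Real.exp_add]
    rw [show -(k * (u ^ α * w ^ α)) + -(k * u ^ α) = -(k * (1 + w ^ α)) * u ^ α by ring]
    ring
  rw [setIntegral_congr_fun measurableSet_Ioi e2, integral_const_mul,
    integral_rpow_mul_exp_neg_mul_rpow h0 (by linarith) (by positivity)]
  have hne : 1 + w ^ α ≠ 0 := by positivity
  rw [sub_add_cancel, neg_div, div_self h0.ne', Real.Gamma_one, Real.rpow_neg_one]
  field_simp

/-- `z^α` has argument `α arg z`, strictly inside `(-π, π)`: either `z^α` is positive or its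
imaginary part is nonzero. The transform thus has no pole and its logarithmic primitive no branch
jump. -/
lemma one_add_cpow_mem_slitPlane {α : ℝ} (h0 : 0 < α) (h1 : α < 1) {z : ℂ}
    (hz : z ∈ Complex.slitPlane) : 1 + z ^ (α : ℂ) ∈ Complex.slitPlane := by
  have hne := Complex.slitPlane_ne_zero hz
  have hn : 0 < ‖z‖ ^ α := Real.rpow_pos_of_pos (norm_pos_iff.2 hne) α
  have ha1 := Complex.neg_pi_lt_arg z
  have ha2 := Complex.arg_le_pi z
  rcases eq_or_ne (z.arg) 0 with h | h
  · refine Or.inl ?_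
    rw [Complex.add_re, Complex.cpow_ofReal_re, h]
    simp
    linarith
  · refine Or.inr ?_
    rw [Complex.add_im, Complex.cpow_ofReal_im, Complex.one_im, zero_add]
    refine mul_ne_zero hn.ne' fun hs => ?_
    have := (Real.sin_eq_zero_iff_of_lt_of_lt (by nlinarith) (by nlinarith)).1 hs
    exact h ((mul_eq_zero.1 this).resolve_right h0.ne')

lemma hasDerivAt_log_one_add_cpow {α : ℝ} (h0 : 0 < α) (h1 : α < 1) {z : ℂ}
    (hz : z ∈ Complex.slitPlane) :
    HasDerivAt (fun z : ℂ => Complex.log (1 + z ^ (α : ℂ)) / α)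
      (z ^ ((α : ℂ) - 1) / (1 + z ^ (α : ℂ))) z := by
  have hd := ((((hasDerivAt_id z).cpow_const (c := (α : ℂ)) hz).const_add 1).clog
    (one_add_cpow_mem_slitPlane h0 h1 hz)).div_const (α : ℂ)
  refine hd.congr_deriv ?_
  have : (α : ℂ) ≠ 0 := Complex.ofReal_ne_zero.2 h0.ne'
  simp only [id, mul_one]
  field_simp

/-- The Stieltjes transform of a law on the positive half line is holomorphic on the slit plane. -/
lemma differentiableOn_integral_inv_add {ν : Measure ℝ} [IsFiniteMeasure ν]
    (hν : ∀ᵐ x ∂ν, 0 < x) :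
    DifferentiableOn ℂ (fun z : ℂ => ∫ x : ℝ, (z + x)⁻¹ ∂ν) Complex.slitPlane := by
  intro z₀ hz₀
  obtain ⟨ε, hε, hball⟩ := Metric.isOpen_iff.1 Complex.isOpen_slitPlane z₀ hz₀
  -- The points `-x` lie on the slit, hence at distance at least `ε` from `z₀`.
  have hdist : ∀ z ∈ Metric.ball z₀ (ε / 2), ∀ x : ℝ, 0 < x → ε / 2 ≤ ‖z + x‖ := by
    intro z hz x hx
    by_contra! hlt
    have hmem : (-(x : ℂ)) ∈ Metric.ball z₀ ε := by
      rw [Metric.mem_ball]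
      refine (dist_triangle _ z _).trans_lt ?_
      have e : dist (-(x : ℂ)) z = ‖z + x‖ := by
        rw [dist_comm, dist_eq_norm, sub_neg_eq_add]
      rw [e]
      have := Metric.mem_ball.1 hz
      linarith
    rcases hball hmem with h | h
    · simp at h; linarith
    · simp at h
  have hm : ∀ z : ℂ, AEStronglyMeasurable (fun x : ℝ => (z + x)⁻¹) ν := fun z => by fun_prop
  have hz₀b : z₀ ∈ Metric.ball z₀ (ε / 2) := Metric.mem_ball_self (by positivity)
  refine DifferentiableAt.differentiableWithinAt ?_
  refine (hasDerivAt_integral_of_dominated_loc_of_deriv_le (μ := ν)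
    (F := fun (z : ℂ) (x : ℝ) => (z + x)⁻¹) (F' := fun z x => -1 / (z + x) ^ 2)
    (bound := fun _ => 1 / (ε / 2) ^ 2) (Metric.ball_mem_nhds z₀ (half_pos hε))
    (Eventually.of_forall hm) ?_ (Measurable.aestronglyMeasurable (by fun_prop)) ?_ (integrable_const _) ?_).2.differentiableAt
  · refine Integrable.of_bound (C := (ε / 2)⁻¹) (hm z₀) ?_
    filter_upwards [hν] with x hx
    rw [norm_inv]
    exact inv_anti₀ (by positivity) (hdist z₀ hz₀b x hx)
  · filter_upwards [hν] with x hx z hz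
    rw [norm_div, norm_neg, norm_one, norm_pow]
    exact one_div_le_one_div_of_le (by positivity)
      (pow_le_pow_left₀ (by positivity) (hdist z hz x hx) 2)
  · filter_upwards [hν] with x hx z hz
    have hne : z + x ≠ 0 := fun h0 => by
      have := hdist z hz x hx
      rw [h0, norm_zero] at this
      linarith
    exact ((hasDerivAt_id z).add_const (x : ℂ)).inv hne

/-- Identity theorem: both sides are analytic on the connected slit plane and agree at positive
reals accumulating at `1`. -/
lemma IsMaxSkewedStable.integral_ratioLaw_inv_add_complex {α : ℝ} {μ : Measure ℝ} (h0 : 0 < α)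
    (h1 : α < 1) (h : IsMaxSkewedStable α μ) {z : ℂ} (hz : z ∈ Complex.slitPlane) :
    ∫ x : ℝ, (z + x)⁻¹ ∂(ratioLaw μ) = z ^ ((α : ℂ) - 1) / (1 + z ^ (α : ℂ)) := by
  have := h.isProbabilityMeasure
  have := isProbabilityMeasure_ratioLaw μ
  have hA : AnalyticOnNhd ℂ (fun z : ℂ => ∫ x : ℝ, (z + x)⁻¹ ∂(ratioLaw μ)) Complex.slitPlane :=
    (differentiableOn_integral_inv_add (ae_ratioLaw_pos (h.ae_pos h0 h1))).analyticOnNhd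
      Complex.isOpen_slitPlane
  have hB : AnalyticOnNhd ℂ (fun z : ℂ => z ^ ((α : ℂ) - 1) / (1 + z ^ (α : ℂ)))
      Complex.slitPlane := by
    refine DifferentiableOn.analyticOnNhd (fun z hz => ?_) Complex.isOpen_slitPlane
    refine DifferentiableAt.differentiableWithinAt ?_
    exact (differentiableAt_id.cpow_const hz).div
      ((differentiableAt_id.cpow_const hz).const_add 1)
      (Complex.slitPlane_ne_zero (one_add_cpow_mem_slitPlane h0 h1 hz))
  have hreal : ∀ w : ℝ, 0 < w → ∫ x : ℝ, ((w : ℂ) + x)⁻¹ ∂(ratioLaw μ) =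
      (w : ℂ) ^ ((α : ℂ) - 1) / (1 + (w : ℂ) ^ (α : ℂ)) := by
    intro w hw
    have e := h.integral_ratioLaw_inv_add h0 h1 hw
    rw [show (α : ℂ) - 1 = ((α - 1 : ℝ) : ℂ) by push_cast; rfl, ← Complex.ofReal_cpow hw.le,
      ← Complex.ofReal_cpow hw.le, ← Complex.ofReal_one, ← Complex.ofReal_add,
      ← Complex.ofReal_div, ← e, ← integral_complex_ofReal]
    simp
  refine hA.eqOn_of_preconnected_of_frequently_eq hB
    (Complex.starConvex_one_slitPlane.isPathConnected
      Complex.one_mem_slitPlane).isConnected.isPreconnected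
    Complex.one_mem_slitPlane ?_ hz
  have ht : Tendsto (fun n : ℕ => (((1 + 1 / ((n : ℝ) + 1)) : ℝ) : ℂ)) atTop (𝓝[≠] 1) := by
    refine tendsto_nhdsWithin_iff.2 ⟨?_, Eventually.of_forall fun n => ?_⟩
    · have h2 : Tendsto (fun n : ℕ => 1 + 1 / ((n : ℝ) + 1)) atTop (𝓝 (1 + 0)) :=
        tendsto_one_div_add_atTop_nhds_zero_nat.const_add 1
      have := (Complex.continuous_ofReal.tendsto _).comp h2
      simpa [Function.comp_def] using this
    · have : (1 : ℝ) / ((n : ℝ) + 1) ≠ 0 := by positivity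
      intro h2
      have h3 : (1 + 1 / ((n : ℝ) + 1) : ℝ) = 1 := Complex.ofReal_eq_one.1 h2
      exact this (by linarith)
  exact ht.frequently (Frequently.of_forall fun n => hreal _ (by positivity))

/-! ### Boundary values and Stieltjes inversion -/

/-- The boundary value at `-r` of `1 + z ^ α` from the upper half plane. -/
noncomputable def upperBoundary (α r : ℝ) : ℂ :=
  1 + (r ^ α : ℝ) * Complex.exp ((Real.pi * α : ℝ) * Complex.I)

lemma upperBoundary_re (α r : ℝ) :
    (upperBoundary α r).re = 1 + r ^ α * Real.cos (Real.pi * α) := by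
  rw [upperBoundary, Complex.add_re, Complex.re_ofReal_mul, Complex.exp_ofReal_mul_I_re,
    Complex.one_re]

lemma upperBoundary_im (α r : ℝ) :
    (upperBoundary α r).im = r ^ α * Real.sin (Real.pi * α) := by
  rw [upperBoundary, Complex.add_im, Complex.im_ofReal_mul, Complex.exp_ofReal_mul_I_im,
    Complex.one_im, zero_add]

lemma sin_pi_mul_pos {α : ℝ} (h0 : 0 < α) (h1 : α < 1) : 0 < Real.sin (Real.pi * α) := by
  have := Real.pi_pos
  exact Real.sin_pos_of_pos_of_lt_pi (by positivity) (by nlinarith)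

lemma upperBoundary_mem_slitPlane {α : ℝ} (h0 : 0 < α) (h1 : α < 1) {r : ℝ} (hr : 0 ≤ r) :
    upperBoundary α r ∈ Complex.slitPlane := by
  rcases hr.eq_or_lt with rfl | hr
  · refine Or.inl ?_
    rw [upperBoundary_re, Real.zero_rpow h0.ne']
    simp
  · refine Or.inr ?_
    rw [upperBoundary_im]
    exact (mul_pos (Real.rpow_pos_of_pos hr α) (sin_pi_mul_pos h0 h1)).ne'

/-- The distribution function of the ratio of two independent maximally skewed stable
variables. -/
noncomputable def ratioDistr (α r : ℝ) : ℝ := (upperBoundary α r).arg / (Real.pi * α)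

lemma ratioDistr_zero {α : ℝ} (h0 : 0 < α) : ratioDistr α 0 = 0 := by
  rw [ratioDistr, upperBoundary, Real.zero_rpow h0.ne']
  simp

lemma continuousAt_ratioDistr {α : ℝ} (h0 : 0 < α) (h1 : α < 1) {r : ℝ} (hr : 0 ≤ r) :
    ContinuousAt (ratioDistr α) r := by
  unfold ratioDistr
  refine ContinuousAt.div_const ?_ _
  refine (Complex.continuousAt_arg (upperBoundary_mem_slitPlane h0 h1 hr)).comp ?_
  have hc := Real.continuousAt_rpow_const r α (Or.inr h0.le)
  exact continuousAt_const.add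
    ((Complex.continuous_ofReal.continuousAt.comp hc).mul continuousAt_const)

lemma mul_cpow_of_arg_add_mem {x y c : ℂ} (hx : x ≠ 0) (hy : y ≠ 0)
    (h : x.arg + y.arg ∈ Ioc (-Real.pi) Real.pi) : (x * y) ^ c = x ^ c * y ^ c := by
  rw [Complex.cpow_def_of_ne_zero hx, Complex.cpow_def_of_ne_zero hy,
    Complex.cpow_def_of_ne_zero (mul_ne_zero hx hy), Complex.log_mul hx hy h, add_mul,
    Complex.exp_add]

/-- Moves the branch cut away: the rotated point stays in the right half plane, where the power is
continuous up to the boundary, so `z` can approach the negative axis from above. -/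
lemma cpow_eq_rotate {α : ℝ} {z : ℂ} (hz : 0 < z.im) :
    z ^ (α : ℂ) = Complex.I ^ (α : ℂ) * (-Complex.I * z) ^ (α : ℂ) := by
  have hne : -Complex.I * z ≠ 0 := by
    refine mul_ne_zero (neg_ne_zero.2 Complex.I_ne_zero) fun h => ?_
    simp [h] at hz
  have harg : |(-Complex.I * z).arg| < Real.pi / 2 := by
    rw [Complex.abs_arg_lt_pi_div_two_iff]
    left
    simpa using hz
  obtain ⟨ha1, ha2⟩ := abs_lt.1 harg
  rw [← mul_cpow_of_arg_add_mem Complex.I_ne_zero hne]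
  · rw [← mul_assoc, mul_neg, Complex.I_mul_I, neg_neg, one_mul]
  · rw [Complex.arg_I]
    constructor <;> linarith

lemma tendsto_one_add_cpow_upperBoundary {α : ℝ} (h0 : 0 < α) {r : ℝ} (hr : 0 ≤ r) :
    Tendsto (fun η : ℝ => 1 + (-(r : ℂ) + η * Complex.I) ^ (α : ℂ)) (𝓝[>] 0)
      (𝓝 (upperBoundary α r)) := by
  have hev : ∀ᶠ η : ℝ in 𝓝[>] 0, 1 + Complex.I ^ (α : ℂ) *
      (-Complex.I * (-(r : ℂ) + η * Complex.I)) ^ (α : ℂ) =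
      1 + (-(r : ℂ) + η * Complex.I) ^ (α : ℂ) := by
    filter_upwards [self_mem_nhdsWithin] with η hη
    rw [← cpow_eq_rotate (z := -(r : ℂ) + η * Complex.I) (by simpa using hη)]
  refine Tendsto.congr' hev ?_
  have hc : ContinuousAt (fun z : ℂ => z ^ (α : ℂ)) (Complex.I * r) := by
    have := Complex.continuousAt_cpow_of_re_pos (p := (Complex.I * r, (α : ℂ)))
      (Or.inl (by simp)) (by simpa using h0)
    exact ContinuousAt.comp (f := fun z : ℂ => (z, (α : ℂ))) this (by fun_prop)
  have hl : Tendsto (fun η : ℝ => -Complex.I * (-(r : ℂ) + η * Complex.I)) (𝓝[>] 0)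
      (𝓝 (Complex.I * r)) := by
    have : Continuous fun η : ℝ => -Complex.I * (-(r : ℂ) + η * Complex.I) := by fun_prop
    have := (this.tendsto 0).mono_left (nhdsWithin_le_nhds (s := Ioi 0))
    simpa using this
  have h := ((hc.tendsto.comp hl).const_mul (Complex.I ^ (α : ℂ))).const_add 1
  have e : upperBoundary α r = 1 + Complex.I ^ (α : ℂ) * (Complex.I * r) ^ (α : ℂ) := by
    rcases hr.eq_or_lt with rfl | hr
    · simp [upperBoundary, Real.zero_rpow h0.ne', h0.ne']
    · have := Real.pi_pos
      rw [upperBoundary, mul_cpow_of_arg_add_mem Complex.I_ne_zero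
        (Complex.ofReal_ne_zero.2 hr.ne'), ← Complex.ofReal_cpow hr.le, ← mul_assoc, mul_comm,
        Complex.cpow_def_of_ne_zero Complex.I_ne_zero, Complex.log_I, ← Complex.exp_add]
      · congr 3
        push_cast
        ring
      · rw [Complex.arg_ofReal_of_nonneg hr.le, Complex.arg_I]
        constructor <;> linarith
  rw [e]
  exact h

lemma continuous_poisson {η : ℝ} (hη : 0 < η) :
    Continuous fun p : ℝ × ℝ => η / ((p.2 - p.1) ^ 2 + η ^ 2) :=
  continuous_const.div (by fun_prop) fun p => by positivity

lemma poisson_le {η : ℝ} (hη : 0 < η) (t : ℝ) : ‖η / (t ^ 2 + η ^ 2)‖ ≤ η⁻¹ := by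
  rw [Real.norm_of_nonneg (by positivity), div_le_iff₀ (by positivity)]
  have : η⁻¹ * (t ^ 2 + η ^ 2) = η⁻¹ * t ^ 2 + η := by field_simp
  rw [this]
  have := mul_nonneg (inv_pos.2 hη).le (sq_nonneg t)
  linarith

/-- Integrating the Poisson integrals of a finite measure over an interval. -/
lemma intervalIntegral_poisson (ν : Measure ℝ) [IsFiniteMeasure ν] {a b η : ℝ} (hab : a ≤ b)
    (hη : 0 < η) :
    ∫ r in a..b, ∫ x, η / ((x - r) ^ 2 + η ^ 2) ∂ν =
      ∫ x, (Real.arctan ((b - x) / η) - Real.arctan ((a - x) / η)) ∂ν := by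
  rw [intervalIntegral.integral_of_le hab, integral_integral_swap]
  · refine integral_congr_ae (Eventually.of_forall fun x => ?_)
    simp only
    rw [← intervalIntegral.integral_of_le hab]
    refine intervalIntegral.integral_eq_sub_of_hasDerivAt
      (f := fun r => Real.arctan ((r - x) / η)) (fun r _ => ?_) ?_
    · have h := (((hasDerivAt_id r).sub_const x).div_const η).arctan
      refine h.congr_deriv ?_
      simp only [id]
      field_simp
      ring
    · refine Continuous.intervalIntegrable ?_ _ _
      exact (continuous_poisson hη).comp (by fun_prop : Continuous fun r : ℝ => (r, x))
  · refine Integrable.of_bound (C := η⁻¹) (continuous_poisson hη).aestronglyMeasurable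
      (Eventually.of_forall fun p => poisson_le hη _)

lemma tendsto_arctan_div_nhdsGT_zero (c : ℝ) :
    Tendsto (fun η : ℝ => Real.arctan (c / η)) (𝓝[>] 0) (𝓝 (Real.pi / 2 * Real.sign c)) := by
  have hinv : Tendsto (fun η : ℝ => η⁻¹) (𝓝[>] 0) atTop := tendsto_inv_nhdsGT_zero
  simp_rw [div_eq_mul_inv]
  rcases lt_trichotomy c 0 with hc | rfl | hc
  · rw [Real.sign_of_neg hc, mul_neg_one]
    have := (Real.tendsto_arctan_atBot.mono_right nhdsWithin_le_nhds).comp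
      (hinv.const_mul_atTop_of_neg hc)
    simpa [Function.comp_def, div_eq_mul_inv] using this
  · simp
  · rw [Real.sign_of_pos hc, mul_one]
    have := (Real.tendsto_arctan_atTop.mono_right nhdsWithin_le_nhds).comp
      (hinv.const_mul_atTop hc)
    simpa [Function.comp_def, div_eq_mul_inv] using this

/-- Stieltjes inversion: the limit of the smoothed interval masses lies between the masses of the
open and of the closed interval. -/
lemma measure_Ioo_le_poisson_limit_le (ν : Measure ℝ) [IsFiniteMeasure ν] {a b L : ℝ}
    (hab : a < b)
    (hL : Tendsto (fun η : ℝ => ∫ r in a..b, ∫ x, η / ((x - r) ^ 2 + η ^ 2) ∂ν) (𝓝[>] 0) (𝓝 L)) :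
    ν.real (Ioo a b) * Real.pi ≤ L ∧ L ≤ ν.real (Icc a b) * Real.pi := by
  have hpi := Real.pi_pos
  -- The pointwise limit of the arctangent difference: `π` inside the interval, `π/2` at its
  -- endpoints, `0` outside. It lies between `π` times the two indicators.
  set g : ℝ → ℝ := fun x => Real.pi / 2 * Real.sign (b - x) - Real.pi / 2 * Real.sign (a - x)
    with hg
  have hlim : Tendsto (fun η : ℝ => ∫ r in a..b, ∫ x, η / ((x - r) ^ 2 + η ^ 2) ∂ν) (𝓝[>] 0)
      (𝓝 (∫ x, g x ∂ν)) := by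
    have h1 : Tendsto (fun η : ℝ => ∫ x, (Real.arctan ((b - x) / η) - Real.arctan ((a - x) / η)) ∂ν)
        (𝓝[>] 0) (𝓝 (∫ x, g x ∂ν)) := by
      refine tendsto_integral_filter_of_dominated_convergence (fun _ => Real.pi)
        (Eventually.of_forall fun η => ?_) (Eventually.of_forall fun η => Eventually.of_forall
          fun x => ?_) (integrable_const _) (Eventually.of_forall fun x => ?_)
      · exact Measurable.aestronglyMeasurable (by fun_prop)
      · rw [Real.norm_eq_abs, abs_le]
        have := Real.arctan_lt_pi_div_two ((b - x) / η)
        have := Real.arctan_lt_pi_div_two ((a - x) / η)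
        have := Real.neg_pi_div_two_lt_arctan ((b - x) / η)
        have := Real.neg_pi_div_two_lt_arctan ((a - x) / η)
        constructor <;> linarith
      · exact (tendsto_arctan_div_nhdsGT_zero _).sub (tendsto_arctan_div_nhdsGT_zero _)
    refine h1.congr' ?_
    filter_upwards [self_mem_nhdsWithin] with η hη
    exact (intervalIntegral_poisson ν hab.le hη).symm
  have hsign : ∀ c : ℝ, |Real.sign c| ≤ 1 := fun c => by
    rcases Real.sign_apply_eq c with h | h | h <;> simp [h]
  have hgm : Measurable g := by
    have : Measurable Real.sign := by
      unfold Real.sign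
      exact Measurable.ite measurableSet_Iio measurable_const
        (Measurable.ite measurableSet_Ioi measurable_const measurable_const)
    fun_prop
  have hgi : Integrable g ν := by
    refine Integrable.of_bound (C := Real.pi) hgm.aestronglyMeasurable
      (Eventually.of_forall fun x => ?_)
    have h1 := abs_le.1 (hsign (b - x))
    have h2 := abs_le.1 (hsign (a - x))
    rw [Real.norm_eq_abs, abs_le]
    constructor <;> simp only [hg] <;> nlinarith
  rw [tendsto_nhds_unique hL hlim, ← smul_eq_mul, ← smul_eq_mul,
    ← integral_indicator_const _ measurableSet_Ioo, ← integral_indicator_const _ measurableSet_Icc]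
  constructor
  · refine integral_mono ((integrable_const _).indicator measurableSet_Ioo) hgi fun x => ?_
    by_cases hx : x ∈ Ioo a b
    · rw [indicator_of_mem hx]
      simp only [hg]
      rw [Real.sign_of_pos (by linarith [hx.2]), Real.sign_of_neg (by linarith [hx.1])]
      linarith
    · rw [indicator_of_notMem hx]
      have h12 : Real.sign (a - x) ≤ Real.sign (b - x) := by
        rcases le_or_gt x a with hxa | hxa
        · rw [Real.sign_of_pos (show 0 < b - x by linarith)]
          exact (abs_le.1 (hsign _)).2
        · rw [Real.sign_of_neg (show a - x < 0 by linarith)]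
          exact (abs_le.1 (hsign _)).1
      simp only [hg]
      nlinarith
  · refine integral_mono hgi ((integrable_const _).indicator measurableSet_Icc) fun x => ?_
    by_cases hx : x ∈ Icc a b
    · rw [indicator_of_mem hx]
      have h1 := abs_le.1 (hsign (b - x))
      have h2 := abs_le.1 (hsign (a - x))
      simp only [hg]
      nlinarith
    · rw [indicator_of_notMem hx]
      simp only [hg]
      rcases lt_or_ge x a with hxa | hxa
      · rw [Real.sign_of_pos (show 0 < b - x by linarith),
          Real.sign_of_pos (show 0 < a - x by linarith)]
        linarith
      · have hxb : b < x := by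
          by_contra! hxb
          exact hx ⟨hxa, hxb⟩
        rw [Real.sign_of_neg (show b - x < 0 by linarith),
          Real.sign_of_neg (show a - x < 0 by linarith)]
        linarith

/-- The Poisson integral is minus the imaginary part of the Stieltjes transform at `-r + iη`. Along
this line, traversed with velocity `-1`, it is the derivative of `Im log (1 + z^α) / α`; as `η → 0`
this becomes `arg / α`. -/
lemma IsMaxSkewedStable.tendsto_poisson_ratioLaw {α : ℝ} {μ : Measure ℝ} (h0 : 0 < α)
    (h1 : α < 1) (h : IsMaxSkewedStable α μ) {a b : ℝ} (ha : 0 ≤ a) (hab : a < b) :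
    Tendsto (fun η : ℝ => ∫ r in a..b, ∫ x, η / ((x - r) ^ 2 + η ^ 2) ∂(ratioLaw μ)) (𝓝[>] 0)
      (𝓝 ((ratioDistr α b - ratioDistr α a) * Real.pi)) := by
  have := h.isProbabilityMeasure
  have := isProbabilityMeasure_ratioLaw μ
  have hb : 0 ≤ b := ha.trans hab.le
  let G : ℝ → ℝ → ℝ := fun η r =>
    (Complex.log (1 + (-(r : ℂ) + η * Complex.I) ^ (α : ℂ)) / α).im
  have hmem : ∀ η r : ℝ, 0 < η → -(r : ℂ) + η * Complex.I ∈ Complex.slitPlane := fun η r hη =>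
    Or.inr (by simpa using hη.ne')
  have hderiv : ∀ η : ℝ, 0 < η → ∀ r : ℝ,
      HasDerivAt (G η) (∫ x, η / ((x - r) ^ 2 + η ^ 2) ∂(ratioLaw μ)) r := by
    intro η hη r
    have hlin : HasDerivAt (fun r : ℝ => -(r : ℂ) + η * Complex.I) (-1) r := by
      simpa using ((Complex.ofRealCLM.hasDerivAt (x := r)).neg.add_const (η * Complex.I))
    have hd := (hasDerivAt_log_one_add_cpow h0 h1 (hmem η r hη)).comp r hlin
    rw [← h.integral_ratioLaw_inv_add_complex h0 h1 (hmem η r hη)] at hd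
    have hd2 := (Complex.imCLM.hasFDerivAt.comp_hasDerivAt r hd)
    refine hd2.congr_deriv ?_
    have hi := integral_im (integrable_inv_add (ratioLaw μ) (w := -(r : ℂ) + η * Complex.I)
      (by simpa using hη))
    simp only [RCLike.im_to_complex] at hi
    rw [Complex.imCLM_apply, mul_neg_one, Complex.neg_im, ← hi, ← integral_neg]
    refine integral_congr_ae (Eventually.of_forall fun x => ?_)
    simp only
    rw [im_inv_add_eq, neg_neg]
    simp [sub_eq_add_neg]
  have hcont : ∀ η : ℝ, 0 < η →
      Continuous fun r : ℝ => ∫ x, η / ((x - r) ^ 2 + η ^ 2) ∂(ratioLaw μ) := by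
    intro η hη
    refine continuous_of_dominated (bound := fun _ => η⁻¹) (fun r => ?_)
      (fun r => Eventually.of_forall fun x => poisson_le hη _) (integrable_const _)
      (Eventually.of_forall fun x => ?_)
    · exact Measurable.aestronglyMeasurable (by fun_prop)
    · exact (continuous_poisson hη).comp (by fun_prop : Continuous fun r : ℝ => (r, x))
  have hint : ∀ η : ℝ, 0 < η →
      ∫ r in a..b, ∫ x, η / ((x - r) ^ 2 + η ^ 2) ∂(ratioLaw μ) = G η b - G η a := fun η hη =>
    intervalIntegral.integral_eq_sub_of_hasDerivAt (fun r _ => hderiv η hη r)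
      ((hcont η hη).intervalIntegrable _ _)
  have hG : ∀ r : ℝ, 0 ≤ r → Tendsto (fun η => G η r) (𝓝[>] 0) (𝓝 (ratioDistr α r * Real.pi)) := by
    intro r hr
    have h2 := (Complex.continuousAt_arg (upperBoundary_mem_slitPlane h0 h1 hr)).tendsto.comp
      (tendsto_one_add_cpow_upperBoundary h0 hr)
    have h3 := h2.div_const α
    have e : ratioDistr α r * Real.pi = (upperBoundary α r).arg / α := by
      rw [ratioDistr]
      have := Real.pi_pos.ne'
      field_simp
    rw [e]
    refine h3.congr fun η => ?_
    simp only [G, Function.comp, Complex.div_ofReal_im, Complex.log_im]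
  rw [sub_mul]
  refine ((hG b hb).sub (hG a ha)).congr' ?_
  filter_upwards [self_mem_nhdsWithin] with η hη
  exact (hint η hη).symm

lemma IsMaxSkewedStable.ratioLaw_Ioo_le {α : ℝ} {μ : Measure ℝ} (h0 : 0 < α) (h1 : α < 1)
    (h : IsMaxSkewedStable α μ) {a b : ℝ} (ha : 0 ≤ a) (hab : a < b) :
    (ratioLaw μ).real (Ioo a b) ≤ ratioDistr α b - ratioDistr α a ∧
      ratioDistr α b - ratioDistr α a ≤ (ratioLaw μ).real (Icc a b) := by
  have := h.isProbabilityMeasure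
  have := isProbabilityMeasure_ratioLaw μ
  obtain ⟨hl, hu⟩ := measure_Ioo_le_poisson_limit_le (ratioLaw μ) hab
    (h.tendsto_poisson_ratioLaw h0 h1 ha hab)
  exact ⟨le_of_mul_le_mul_right hl Real.pi_pos, le_of_mul_le_mul_right hu Real.pi_pos⟩

/-- Inversion controls only open intervals from above and closed ones from below; continuity of the
candidate rules out atoms, which closes the gap. -/
lemma IsMaxSkewedStable.ratioLaw_singleton {α : ℝ} {μ : Measure ℝ} (h0 : 0 < α) (h1 : α < 1)
    (h : IsMaxSkewedStable α μ) {r : ℝ} (hr : 0 ≤ r) : (ratioLaw μ).real {r} = 0 := by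
  have := h.isProbabilityMeasure
  have := isProbabilityMeasure_ratioLaw μ
  rcases hr.eq_or_lt with rfl | hr
  · have h2 := ae_ratioLaw_pos (h.ae_pos h0 h1)
    rw [measureReal_eq_zero_iff]
    exact measure_mono_null (fun x hx => by simp [mem_singleton_iff.1 hx]) (ae_iff.1 h2)
  have hle : ∀ᶠ δ in 𝓝[>] (0 : ℝ),
      (ratioLaw μ).real {r} ≤ ratioDistr α (r + δ) - ratioDistr α (r - δ) := by
    filter_upwards [Ioo_mem_nhdsGT hr] with δ hδ
    refine le_trans (measureReal_mono ?_)
      (h.ratioLaw_Ioo_le h0 h1 (sub_nonneg.2 hδ.2.le) (by linarith [hδ.1])).1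
    rw [singleton_subset_iff]
    exact ⟨by linarith [hδ.1], by linarith [hδ.1]⟩
  have hc := continuousAt_ratioDistr h0 h1 hr.le
  have hlim : Tendsto (fun δ : ℝ => ratioDistr α (r + δ) - ratioDistr α (r - δ)) (𝓝[>] 0)
      (𝓝 0) := by
    have e1 : Tendsto (fun δ : ℝ => r + δ) (𝓝[>] 0) (𝓝 r) := by
      have : Continuous fun δ : ℝ => r + δ := by fun_prop
      simpa using (this.tendsto 0).mono_left (nhdsWithin_le_nhds (s := Ioi 0))
    have e2 : Tendsto (fun δ : ℝ => r - δ) (𝓝[>] 0) (𝓝 r) := by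
      have : Continuous fun δ : ℝ => r - δ := by fun_prop
      simpa using (this.tendsto 0).mono_left (nhdsWithin_le_nhds (s := Ioi 0))
    simpa using (hc.tendsto.comp e1).sub (hc.tendsto.comp e2)
  exact le_antisymm (ge_of_tendsto hlim hle) measureReal_nonneg

/-- The distribution function of the ratio in closed form. -/
lemma IsMaxSkewedStable.ratioLaw_Iio {α : ℝ} {μ : Measure ℝ} (h0 : 0 < α) (h1 : α < 1)
    (h : IsMaxSkewedStable α μ) {r : ℝ} (hr : 0 ≤ r) :
    (ratioLaw μ).real (Iio r) = ratioDistr α r ∧ (ratioLaw μ).real (Iic r) = ratioDistr α r := by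
  have := h.isProbabilityMeasure
  have := isProbabilityMeasure_ratioLaw μ
  have hpos := ae_ratioLaw_pos (h.ae_pos h0 h1)
  have hsing : ∀ᵐ x ∂(ratioLaw μ), x ≠ r := by
    have := (measureReal_eq_zero_iff).1 (h.ratioLaw_singleton h0 h1 hr)
    rw [ae_iff]
    simpa using this
  have e1 : (ratioLaw μ).real (Iio r) = (ratioLaw μ).real (Ioo 0 r) := by
    refine measureReal_congr ?_
    filter_upwards [hpos] with x hx
    exact propext ⟨fun h => ⟨hx, h⟩, fun h => h.2⟩
  have e2 : (ratioLaw μ).real (Iic r) = (ratioLaw μ).real (Ioo 0 r) := by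
    refine measureReal_congr ?_
    filter_upwards [hpos, hsing] with x hx hx2
    exact propext ⟨fun h => ⟨hx, lt_of_le_of_ne h hx2⟩, fun h => h.2.le⟩
  have e3 : (ratioLaw μ).real (Icc 0 r) = (ratioLaw μ).real (Ioo 0 r) := by
    refine measureReal_congr ?_
    filter_upwards [hpos, hsing] with x hx hx2
    exact propext ⟨fun h => ⟨hx, lt_of_le_of_ne h.2 hx2⟩, fun h => ⟨h.1.le, h.2.le⟩⟩
  have key : (ratioLaw μ).real (Ioo 0 r) = ratioDistr α r := by
    rcases hr.eq_or_lt with rfl | hr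
    · simp [ratioDistr_zero h0]
    · have := h.ratioLaw_Ioo_le h0 h1 le_rfl hr
      rw [ratioDistr_zero h0, sub_zero, e3] at this
      exact le_antisymm this.1 this.2
  exact ⟨e1.trans key, e2.trans key⟩

/-! ### A trigonometric inequality by convexity in `α` -/

lemma mul_sin_le_mul_sin {c d a : ℝ} (hc : 0 < c) (hcd : c ≤ d) (ha : 0 < a)
    (had : d * a ≤ Real.pi) : c * Real.sin (d * a) ≤ d * Real.sin (c * a) := by
  have hd : 0 < d := hc.trans_le hcd
  have h := strictConcaveOn_sin_Icc.concaveOn.2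
    (show d * a ∈ Icc 0 Real.pi from ⟨by positivity, had⟩) ⟨le_rfl, Real.pi_pos.le⟩
    (show 0 ≤ c / d by positivity)
    (show 0 ≤ 1 - c / d by rw [sub_nonneg, div_le_one hd]; exact hcd) (by ring)
  simp only [smul_eq_mul, Real.sin_zero, mul_zero, add_zero] at h
  rw [show c / d * (d * a) = c * a by field_simp] at h
  calc c * Real.sin (d * a) = d * (c / d * Real.sin (d * a)) := by field_simp
    _ ≤ _ := mul_le_mul_of_nonneg_left h hd.le

lemma sinc_pos_of_lt_pi {x : ℝ} (hx : 0 ≤ x) (hx2 : x < Real.pi) : 0 < Real.sinc x := by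
  rcases hx.eq_or_lt with rfl | h
  · simp
  · rw [Real.sinc_of_ne_zero h.ne']
    exact div_pos (Real.sin_pos_of_pos_of_lt_pi h hx2) h

lemma hasDerivAt_log_sin_mul {c a : ℝ} (h : Real.sin (c * a) ≠ 0) :
    HasDerivAt (fun a : ℝ => Real.log (Real.sin (c * a)))
      (c * (Real.cos (c * a) / Real.sin (c * a))) a := by
  have := (((hasDerivAt_id a).const_mul c).sin).log h
  refine this.congr_deriv ?_
  simp only [id, mul_one]
  ring

lemma hasDerivAt_mul_cot_mul {c a : ℝ} (h : Real.sin (c * a) ≠ 0) :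
    HasDerivAt (fun a : ℝ => c * (Real.cos (c * a) / Real.sin (c * a)))
      (-(c / Real.sin (c * a)) ^ 2) a := by
  have := ((((hasDerivAt_id a).const_mul c).cos).div (((hasDerivAt_id a).const_mul c).sin)
    h).const_mul c
  refine this.congr_deriv ?_
  simp only [id, mul_one]
  rw [div_pow]
  field_simp
  have := Real.sin_sq_add_cos_sq (c * a)
  linear_combination -c ^ 2 * this

/-- The second derivative is `(d / sin (da))² - (c / sin (ca))²`, nonnegative because `sin x / x`
decreases. Using `sinc` keeps the function continuous at `a = 0`. -/
lemma convexOn_log_sinc_sub {c d : ℝ} (hc : 0 < c) (hcd : c ≤ d) (hd : d < Real.pi) :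
    ConvexOn ℝ (Icc 0 1)
      (fun a : ℝ => Real.log (Real.sinc (c * a)) - Real.log (Real.sinc (d * a))) := by
  have hd0 : 0 < d := hc.trans_le hcd
  have hsc : ∀ e, 0 < e → e < Real.pi → ∀ a ∈ Icc (0 : ℝ) 1, Real.sinc (e * a) ≠ 0 := by
    intro e he he2 a ha
    exact (sinc_pos_of_lt_pi (mul_nonneg he.le ha.1) (by nlinarith [ha.1, ha.2])).ne'
  have hsin : ∀ e, 0 < e → e < Real.pi → ∀ a ∈ Ioo (0 : ℝ) 1, 0 < Real.sin (e * a) := by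
    intro e he he2 a ha
    exact Real.sin_pos_of_pos_of_lt_pi (mul_pos he ha.1) (by nlinarith [ha.1, ha.2])
  have hcpi := hcd.trans_lt hd
  refine convexOn_of_hasDerivWithinAt2_nonneg (convex_Icc 0 1)
    (f' := fun a => c * (Real.cos (c * a) / Real.sin (c * a)) -
      d * (Real.cos (d * a) / Real.sin (d * a)))
    (f'' := fun a => -(c / Real.sin (c * a)) ^ 2 - -(d / Real.sin (d * a)) ^ 2) ?_ ?_ ?_ ?_
  · refine ContinuousOn.sub ?_ ?_
    · exact (Real.continuous_sinc.comp (continuous_const_mul c)).continuousOn.log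
        (hsc c hc hcpi)
    · exact (Real.continuous_sinc.comp (continuous_const_mul d)).continuousOn.log
        (hsc d hd0 hd)
  · rw [interior_Icc]
    intro a ha
    have h1 := hsin c hc hcpi a ha
    have h2 := hsin d hd0 hd a ha
    -- Passing from `sin` to `sinc`, the terms `log a` cancel and only the constant `log d - log c`
    -- remains.
    have hd := ((hasDerivAt_log_sin_mul h1.ne').sub (hasDerivAt_log_sin_mul h2.ne')).add_const
      (Real.log d - Real.log c)
    refine (hd.congr_of_eventuallyEq ?_).hasDerivWithinAt
    filter_upwards [isOpen_Ioo.mem_nhds ha] with b hb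
    have hb0 : b ≠ 0 := hb.1.ne'
    have h1 := hsin c hc hcpi b hb
    have h2 := hsin d hd0 ‹_› b hb
    rw [Real.sinc_of_ne_zero (mul_ne_zero hc.ne' hb0), Real.sinc_of_ne_zero
      (mul_ne_zero hd0.ne' hb0), Real.log_div h1.ne' (mul_ne_zero hc.ne' hb0),
      Real.log_div h2.ne' (mul_ne_zero hd0.ne' hb0), Real.log_mul hc.ne' hb0,
      Real.log_mul hd0.ne' hb0]
    simp only [Pi.sub_apply]
    ring
  · rw [interior_Icc]
    intro a ha
    exact ((hasDerivAt_mul_cot_mul (hsin c hc hcpi a ha).ne').sub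
      (hasDerivAt_mul_cot_mul (hsin d hd0 hd a ha).ne')).hasDerivWithinAt
  · rw [interior_Icc]
    intro a ha
    have h1 := hsin c hc hcpi a ha
    have h2 := hsin d hd0 hd a ha
    have h3 : c / Real.sin (c * a) ≤ d / Real.sin (d * a) := by
      rw [div_le_div_iff₀ h1 h2]
      exact mul_sin_le_mul_sin hc hcd ha.1 (by nlinarith [ha.1, ha.2])
    have h4 := pow_le_pow_left₀ (by positivity) h3 2
    linarith

lemma sin_div_sin_le_rpow {α s : ℝ} (h0 : 0 < α) (h1 : α < 1) (hs : 0 < s) (hs2 : s ≤ 1 / 2) :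
    Real.sin (Real.pi * α * s) / Real.sin (Real.pi * α * (1 - s)) ≤
      (s / (1 - s)) ^ (1 - α) := by
  have hpi := Real.pi_pos
  have hs1 : 0 < 1 - s := by linarith
  set c := Real.pi * s with hc
  set d := Real.pi * (1 - s) with hd
  have hc0 : 0 < c := by positivity
  have hd0 : 0 < d := by positivity
  have hcd : c ≤ d := mul_le_mul_of_nonneg_left (by linarith) hpi.le
  have hdpi : d < Real.pi := by rw [hd]; nlinarith
  -- The convex function is `0` at `0` and, since `sin (π(1-s)) = sin (πs)`, equals `log ((1-s)/s)`
  -- at `1`; at `α` it lies below the chord.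
  have hconv := (convexOn_log_sinc_sub hc0 hcd hdpi).2 (left_mem_Icc.2 zero_le_one)
    (right_mem_Icc.2 zero_le_one) (show 0 ≤ 1 - α by linarith) h0.le (by ring)
  simp only [smul_eq_mul, mul_zero, mul_one, zero_add, Real.sinc_zero, Real.log_one,
    sub_self] at hconv
  have hca : 0 < Real.sin (c * α) :=
    Real.sin_pos_of_pos_of_lt_pi (by positivity) (by nlinarith)
  have hda : 0 < Real.sin (d * α) :=
    Real.sin_pos_of_pos_of_lt_pi (by positivity) (by nlinarith)
  have hsd : Real.sin d = Real.sin c := by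
    rw [hd, hc, show Real.pi * (1 - s) = Real.pi - Real.pi * s by ring, Real.sin_pi_sub]
  have hsc : 0 < Real.sin c := Real.sin_pos_of_pos_of_lt_pi hc0 (by linarith)
  rw [Real.sinc_of_ne_zero (by positivity), Real.sinc_of_ne_zero (by positivity),
    Real.sinc_of_ne_zero hc0.ne', Real.sinc_of_ne_zero hd0.ne', hsd,
    Real.log_div hca.ne' (by positivity), Real.log_div hda.ne' (by positivity),
    Real.log_div hsc.ne' hc0.ne', Real.log_div hsc.ne' hd0.ne',
    Real.log_mul hc0.ne' h0.ne', Real.log_mul hd0.ne' h0.ne', hc, hd,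
    Real.log_mul hpi.ne' hs.ne', Real.log_mul hpi.ne' hs1.ne', ← hc, ← hd] at hconv
  rw [show Real.pi * α * s = c * α by rw [hc]; ring,
    show Real.pi * α * (1 - s) = d * α by rw [hd]; ring]
  rw [← Real.log_le_log_iff (div_pos hca hda) (by positivity), Real.log_rpow (by positivity),
    Real.log_div hca.ne' hda.ne', Real.log_div hs.ne' hs1.ne']
  linarith

/-! ### Bounds for the distribution function -/

section Bounds

variable {α r : ℝ}

lemma norm_mul_sin_arg_upperBoundary (α r : ℝ) :
    ‖upperBoundary α r‖ * Real.sin (upperBoundary α r).arg = r ^ α * Real.sin (Real.pi * α) := by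
  rw [Complex.norm_mul_sin_arg, upperBoundary_im]

lemma norm_mul_cos_arg_upperBoundary (α r : ℝ) :
    ‖upperBoundary α r‖ * Real.cos (upperBoundary α r).arg =
      1 + r ^ α * Real.cos (Real.pi * α) := by
  rw [Complex.norm_mul_cos_arg, upperBoundary_re]

lemma norm_upperBoundary_le_two (h0 : 0 < α) (hr : 0 ≤ r) (hr1 : r ≤ 1) :
    ‖upperBoundary α r‖ ≤ 2 := by
  refine (norm_add_le _ _).trans ?_
  rw [norm_one, norm_mul, Complex.norm_exp_ofReal_mul_I, Complex.norm_real,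
    Real.norm_of_nonneg (Real.rpow_nonneg hr α)]
  linarith [Real.rpow_le_one hr hr1 h0.le]

lemma norm_upperBoundary_pos (h0 : 0 < α) (h1 : α < 1) (hr : 0 ≤ r) :
    0 < ‖upperBoundary α r‖ :=
  norm_pos_iff.2 (Complex.slitPlane_ne_zero (upperBoundary_mem_slitPlane h0 h1 hr))

lemma arg_upperBoundary_nonneg (h0 : 0 < α) (h1 : α < 1) (hr : 0 ≤ r) :
    0 ≤ (upperBoundary α r).arg := by
  rw [Complex.arg_nonneg_iff, upperBoundary_im]
  exact mul_nonneg (Real.rpow_nonneg hr α) (sin_pi_mul_pos h0 h1).le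

lemma cos_pi_mul_nonneg (h0 : 0 < α) (hα : α ≤ 1 / 2) : 0 ≤ Real.cos (Real.pi * α) := by
  have := Real.pi_pos
  exact Real.cos_nonneg_of_neg_pi_div_two_le_of_le (by nlinarith) (by nlinarith)

lemma arg_upperBoundary_lt_pi_div_two (h0 : 0 < α) (hα : α ≤ 1 / 2) (hr : 0 ≤ r) :
    |(upperBoundary α r).arg| < Real.pi / 2 := by
  rw [Complex.abs_arg_lt_pi_div_two_iff, upperBoundary_re]
  left
  have := mul_nonneg (Real.rpow_nonneg hr α) (cos_pi_mul_nonneg h0 hα)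
  linarith

/-- For `α ≤ 1/2` the real part of the boundary value is at least `1`, so `φ ≤ tan φ ≤ r^α sin (πα)
≤ r^α πα`. -/
lemma ratioDistr_le_rpow (h0 : 0 < α) (hα : α ≤ 1 / 2) (hr : 0 ≤ r) :
    ratioDistr α r ≤ r ^ α := by
  have hpi := Real.pi_pos
  have h1 : α < 1 := by linarith
  have hu := Real.rpow_nonneg hr α
  rw [ratioDistr, div_le_iff₀ (by positivity)]
  have ht := Real.le_tan (arg_upperBoundary_nonneg h0 h1 hr)
    (abs_lt.1 (arg_upperBoundary_lt_pi_div_two h0 hα hr)).2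
  refine ht.trans ?_
  have hcos := mul_nonneg hu (cos_pi_mul_nonneg h0 hα)
  rw [Complex.tan_arg, upperBoundary_re, upperBoundary_im, div_le_iff₀ (by linarith)]
  have hs : Real.sin (Real.pi * α) ≤ Real.pi * α := Real.sin_le (by positivity)
  have h2 := mul_le_mul_of_nonneg_left hs hu
  have h3 : 0 ≤ r ^ α * (Real.pi * α) := by positivity
  nlinarith

/-- Jordan's inequality gives `sin (πα) ≥ 2α`; the boundary value has modulus at most `2`, so `2φ ≥
2α r^α`. -/
lemma rpow_div_pi_le_ratioDistr (h0 : 0 < α) (hα : α ≤ 1 / 2) (hr : 0 ≤ r) (hr1 : r ≤ 1) :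
    1 / Real.pi * r ^ α ≤ ratioDistr α r := by
  have hpi := Real.pi_pos
  have h1 : α < 1 := by linarith
  have hu := Real.rpow_nonneg hr α
  have hφ := arg_upperBoundary_nonneg h0 h1 hr
  rw [ratioDistr, le_div_iff₀ (by positivity)]
  have e := norm_mul_sin_arg_upperBoundary α r
  have hs := Real.sin_le hφ
  have hsin := Real.mul_le_sin (x := Real.pi * α) (by positivity) (by nlinarith)
  have h2 : r ^ α * (2 / Real.pi * (Real.pi * α)) ≤ 2 * (upperBoundary α r).arg := by
    calc _ ≤ r ^ α * Real.sin (Real.pi * α) := mul_le_mul_of_nonneg_left hsin hu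
      _ = _ := e.symm
      _ ≤ ‖upperBoundary α r‖ * (upperBoundary α r).arg :=
        mul_le_mul_of_nonneg_left hs (norm_nonneg _)
      _ ≤ _ := mul_le_mul_of_nonneg_right (norm_upperBoundary_le_two h0 hr hr1) hφ
  have e2 : r ^ α * (2 / Real.pi * (Real.pi * α)) = 2 * (r ^ α * α) := by field_simp
  have e3 : 1 / Real.pi * r ^ α * (Real.pi * α) = r ^ α * α := by field_simp
  rw [e3]
  linarith

lemma ratioDistr_half (hr : 0 ≤ r) :
    ratioDistr (1 / 2) r = 2 / Real.pi * Real.arctan (√r) := by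
  have hpi := Real.pi_pos
  have hlt := abs_lt.1 (arg_upperBoundary_lt_pi_div_two (α := 1 / 2) (by norm_num) le_rfl hr)
  rw [ratioDistr, ← Real.arctan_tan hlt.1 hlt.2, Complex.tan_arg, upperBoundary_re,
    upperBoundary_im, show Real.pi * (1 / 2) = Real.pi / 2 by ring, Real.cos_pi_div_two,
    Real.sin_pi_div_two, Real.sqrt_eq_rpow]
  rw [mul_zero, add_zero, mul_one, div_one]
  field_simp

/-- `u ^ p / (1 + u ^ p)` is a lower bound for the distribution function of the ratio on
`[0, 1]`, where `p = α / (1 - α)`. -/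
lemma rpow_le_ratioDistr_mul (h0 : 0 < α) (h1 : α < 1) (hr : 0 ≤ r) (hr1 : r ≤ 1) :
    r ^ (α / (1 - α)) ≤ ratioDistr α r * (1 + r ^ (α / (1 - α))) := by
  have hpi := Real.pi_pos
  have hβ : 0 < 1 - α := by linarith
  rcases hr.eq_or_lt with rfl | hr0
  · rw [Real.zero_rpow (by positivity), ratioDistr_zero h0]
    simp
  have hu : 0 < r ^ α := Real.rpow_pos_of_pos hr0 α
  have hu1 : r ^ α ≤ 1 := Real.rpow_le_one hr hr1 h0.le
  set φ := (upperBoundary α r).arg with hφ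
  set θ := Real.pi * α with hθ
  have hθ0 : 0 < θ := by positivity
  have hθpi : θ < Real.pi := by rw [hθ]; nlinarith
  have hn := norm_upperBoundary_pos h0 h1 hr
  have es : ‖upperBoundary α r‖ * Real.sin φ = r ^ α * Real.sin θ :=
    norm_mul_sin_arg_upperBoundary α r
  have ec : ‖upperBoundary α r‖ * Real.cos φ = 1 + r ^ α * Real.cos θ :=
    norm_mul_cos_arg_upperBoundary α r
  have hsθ : 0 < Real.sin θ := sin_pi_mul_pos h0 h1
  have hφpi : φ ≤ Real.pi := Complex.arg_le_pi _
  have hφ0 : 0 < φ := by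
    refine lt_of_le_of_ne (arg_upperBoundary_nonneg h0 h1 hr) fun h => ?_
    rw [← h, Real.sin_zero, mul_zero] at es
    exact (mul_pos hu hsθ).ne es
  -- Since `r^α ≤ 1`, the sum `1 + r^α e^{iθ}` leans towards `1` and lies below the bisector of the
  -- angle `θ`. This gives `s ≤ 1/2`.
  have hφhalf : φ ≤ θ / 2 := by
    by_contra! hlt
    have h2 : 0 < Real.sin (φ - θ / 2) :=
      Real.sin_pos_of_pos_of_lt_pi (by linarith) (by linarith)
    have hh : 0 < Real.sin (θ / 2) := Real.sin_pos_of_pos_of_lt_pi (by linarith) (by linarith)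
    have e : ‖upperBoundary α r‖ * Real.sin (φ - θ / 2) = (r ^ α - 1) * Real.sin (θ / 2) := by
      have d1 : Real.sin θ = 2 * Real.sin (θ / 2) * Real.cos (θ / 2) := by
        rw [← Real.sin_two_mul]; ring_nf
      have d2 : Real.cos θ = 1 - 2 * Real.sin (θ / 2) ^ 2 := by
        have := Real.cos_two_mul (θ / 2)
        have h3 := Real.sin_sq_add_cos_sq (θ / 2)
        rw [show 2 * (θ / 2) = θ by ring] at this
        linarith
      rw [Real.sin_sub, mul_sub, ← mul_assoc, ← mul_assoc, es, ec, d1, d2]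
      have h3 := Real.sin_sq_add_cos_sq (θ / 2)
      linear_combination 2 * r ^ α * Real.sin (θ / 2) * h3
    have := mul_pos hn h2
    nlinarith
  -- Law of sines in the triangle with vertices `0`, `1`, `1 + r^α e^{iθ}`; divided into `es` it
  -- expresses `r^α` by `φ`.
  have hsub : ‖upperBoundary α r‖ * Real.sin (θ - φ) = Real.sin θ := by
    rw [Real.sin_sub]
    linear_combination Real.sin θ * ec - Real.cos θ * es
  have hsφ : 0 < Real.sin (θ - φ) := Real.sin_pos_of_pos_of_lt_pi (by linarith) (by linarith)
  set s := ratioDistr α r with hs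
  have hsφe : θ * s = φ := by
    rw [hs, ratioDistr, ← hφ, ← hθ]
    field_simp
  have hs0 : 0 < s := div_pos hφ0 hθ0
  have hs2 : s ≤ 1 / 2 := by
    by_contra! hlt
    have := mul_lt_mul_of_pos_left hlt hθ0
    linarith
  have key := sin_div_sin_le_rpow h0 h1 hs0 hs2
  rw [← hθ, mul_sub, mul_one, hsφe] at key
  have hu2 : r ^ α = Real.sin φ / Real.sin (θ - φ) := by
    rw [eq_div_iff hsφ.ne']
    refine mul_left_cancel₀ hn.ne' ?_
    rw [es]
    linear_combination r ^ α * hsub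
  rw [← hu2] at key
  have hq : 0 ≤ s / (1 - s) := div_nonneg hs0.le (by linarith)
  have h3 := Real.rpow_le_rpow hu.le key (inv_pos.2 hβ).le
  rw [← Real.rpow_mul hr, ← Real.rpow_mul hq, mul_inv_cancel₀ hβ.ne', Real.rpow_one,
    ← div_eq_mul_inv, le_div_iff₀ (by linarith)] at h3
  linarith

end Bounds

/-! ### Stability, independent columns and the tail -/

lemma ratioCDF_eq_ratioDistr {α : ℝ} {μ : Measure ℝ} (h0 : 0 < α) (h1 : α < 1)
    (h : IsMaxSkewedStable α μ) {r : ℝ} (hr : 0 ≤ r) :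
    ratioCDF α μ (r ^ (α / (1 - α))) = ratioDistr α r := by
  have := h.isProbabilityMeasure
  rw [← (h.ratioLaw_Iio h0 h1 hr).2, ratioLaw,
    map_measureReal_apply measurable_ratio measurableSet_Iic, ratioCDF]
  refine measureReal_congr ?_
  filter_upwards [ae_prod_pos (h.ae_pos h0 h1)] with S hS
  exact propext (Real.rpow_le_rpow_iff (div_pos hS.2 hS.1).le hr
    (div_pos h0 (sub_pos.2 h1)))

/-- Scaling the argument of the characteristic function of a maximally skewed stable law. -/
lemma IsMaxSkewedStable.charFun_mul {α : ℝ} {μ : Measure ℝ} (h0 : 0 < α)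
    (h : IsMaxSkewedStable α μ) {c : ℝ} (hc : 0 ≤ c) (l : ℝ) :
    charFun μ (c * l) = Complex.exp (((c ^ α : ℝ) : ℂ) * (-((|l| ^ α : ℝ) : ℂ) *
      (1 - ((Real.sign l : ℝ) : ℂ) * Complex.I * ((Real.tan (Real.pi * α / 2) : ℝ) : ℂ)))) := by
  rw [h.charFun_eq]
  rcases hc.eq_or_lt with rfl | hc
  · simp [Real.zero_rpow h0.ne']
  · have hs : Real.sign (c * l) = Real.sign l := by
      rcases lt_trichotomy l 0 with hl | rfl | hl
      · rw [Real.sign_of_neg hl, Real.sign_of_neg (mul_neg_of_pos_of_neg hc hl)]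
      · simp
      · rw [Real.sign_of_pos hl, Real.sign_of_pos (mul_pos hc hl)]
    rw [hs, abs_mul, abs_of_pos hc, Real.mul_rpow hc.le (abs_nonneg l)]
    congr 1
    push_cast
    ring

/-- Stability: a nonnegative combination of independent maximally skewed stable variables is a
multiple of one such variable. -/
lemma IsMaxSkewedStable.map_sum_mul {α : ℝ} {μ : Measure ℝ} (h0 : 0 < α)
    (h : IsMaxSkewedStable α μ) {N : ℕ} {c : Fin N → ℝ} (hc : ∀ l, 0 ≤ c l)
    (t : Finset (Fin N)) :
    (Measure.pi fun _ : Fin N => μ).map (fun v => ∑ l ∈ t, c l * v l) =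
      μ.map fun y => (∑ l ∈ t, c l ^ α) ^ (1 / α) * y := by
  have := h.isProbabilityMeasure
  have hind : iIndepFun (fun (l : Fin N) (v : Fin N → ℝ) => c l * v l)
      (Measure.pi fun _ : Fin N => μ) :=
    iIndepFun_pi (X := fun l y => c l * y) fun l => by fun_prop
  have hsum : 0 ≤ ∑ l ∈ t, c l ^ α := Finset.sum_nonneg fun l _ => Real.rpow_nonneg (hc l) α
  have hlaw : ∀ l : Fin N, (Measure.pi fun _ : Fin N => μ).map (fun v => c l * v l) =
      μ.map fun y => c l * y := by
    intro l
    have e := (measurePreserving_eval (fun _ : Fin N => μ) l).map_eq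
    rw [← e, Measure.map_map (by fun_prop) (by fun_prop)]
    rw [e]
    rfl
  have : IsFiniteMeasure ((Measure.pi fun _ : Fin N => μ).map fun v => ∑ l ∈ t, c l * v l) :=
    Measure.isFiniteMeasure_map _ _
  have : IsFiniteMeasure (μ.map fun y => (∑ l ∈ t, c l ^ α) ^ (1 / α) * y) :=
    Measure.isFiniteMeasure_map _ _
  refine Measure.ext_of_charFun ?_
  rw [iIndepFun.charFun_map_fun_finsetSum_eq_prod
    (fun l _ => Measurable.aemeasurable (by fun_prop)) (hind.restrict t)]
  ext l
  simp_rw [Finset.prod_apply, hlaw, charFun_map_mul]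
  rw [h.charFun_mul h0 (Real.rpow_nonneg hsum _), ← Real.rpow_mul hsum, one_div,
    inv_mul_cancel₀ h0.ne', Real.rpow_one,
    Finset.prod_congr rfl fun j _ => h.charFun_mul h0 (hc j) l, ← Complex.exp_sum,
    ← Finset.sum_mul, Complex.ofReal_sum]

/-- The joint law of one entry and of the weighted sum of the other ones. -/
lemma IsMaxSkewedStable.map_entry_sum {α : ℝ} {μ : Measure ℝ} (h0 : 0 < α)
    (h : IsMaxSkewedStable α μ) {N : ℕ} {x : Fin N → ℝ} (hx : ∀ l, 0 ≤ x l) (i : Fin N) :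
    (Measure.pi fun _ : Fin N => μ).map
        (fun v => (v i, ∑ l ∈ Finset.univ.erase i, x l * v l)) =
      (μ.prod μ).map fun S => (S.1, thetaExcept α x i * S.2) := by
  classical
  have := h.isProbabilityMeasure
  -- With coefficient `1` at `i`, the entry `v i` belongs to the same independent family as the
  -- summands, even when `x i = 0`.
  let c : Fin N → ℝ := Function.update x i 1
  have hcl : ∀ l ∈ Finset.univ.erase i, c l = x l := fun l hl =>
    Function.update_of_ne (Finset.ne_of_mem_erase hl) _ _
  have hci : c i = 1 := Function.update_self ..
  have hind : iIndepFun (fun (l : Fin N) (v : Fin N → ℝ) => c l * v l)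
      (Measure.pi fun _ : Fin N => μ) :=
    iIndepFun_pi (X := fun l y => c l * y) fun l => by fun_prop
  have hpair := hind.indepFun_finsetSum_of_notMem (fun l => by fun_prop)
    (Finset.notMem_erase i Finset.univ)
  have e1 : (∑ l ∈ Finset.univ.erase i, fun v : Fin N → ℝ => c l * v l) =
      fun v => ∑ l ∈ Finset.univ.erase i, x l * v l := by
    ext v
    rw [Finset.sum_apply]
    exact Finset.sum_congr rfl fun l hl => by rw [hcl l hl]
  rw [e1] at hpair
  simp only [hci, one_mul] at hpair
  rw [hpair.symm.map_prod_eq_prod_map_map (Measurable.aemeasurable (by fun_prop))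
    (Measurable.aemeasurable (by fun_prop)), h.map_sum_mul h0 hx,
    (measurePreserving_eval (fun _ : Fin N => μ) i).map_eq]
  have := Measure.map_prod_map μ μ measurable_id
    (show Measurable fun y : ℝ => thetaExcept α x i * y by fun_prop)
  rw [Measure.map_id] at this
  exact this

/-- The columns of an i.i.d. design are i.i.d. with independent entries. -/
lemma IsIIDDesign.map_columns {Ω : Type*} [MeasurableSpace Ω] {P : Measure Ω}
    [IsProbabilityMeasure P] {μ : Measure ℝ} [IsProbabilityMeasure μ] {N M : ℕ}
    {s : Fin N → Fin M → Ω → ℝ} (hs : IsIIDDesign P μ s) :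
    AEMeasurable (fun ω (j : Fin M) (i : Fin N) => s i j ω) P ∧
      P.map (fun ω (j : Fin M) (i : Fin N) => s i j ω) =
        Measure.pi fun _ : Fin M => Measure.pi fun _ : Fin N => μ := by
  have hm : AEMeasurable (fun ω (p : Fin M × Fin N) => s p.2 p.1 ω) P :=
    aemeasurable_pi_iff.2 fun p => (hs.hasLaw p.2 p.1).aemeasurable
  have hind : iIndepFun (fun (p : Fin M × Fin N) => s p.2 p.1) P :=
    hs.indep.precomp (g := Prod.swap) Prod.swap_injective
  have hlaw := hind.hasLaw_infinitePi (μ := fun _ => μ) (fun p : Fin M × Fin N => hs.hasLaw p.2 p.1) hm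
  refine ⟨aemeasurable_pi_iff.2 fun j => aemeasurable_pi_iff.2 fun i =>
    (hs.hasLaw i j).aemeasurable, ?_⟩
  have hc := Measure.infinitePi_map_curry (fun (_ : Fin M) (_ : Fin N) => μ)
  rw [← hlaw.map_eq, AEMeasurable.map_map_of_aemeasurable
    (MeasurableEquiv.measurable _).aemeasurable hm] at hc
  simp only [Measure.infinitePi_eq_pi] at hc
  exact hc

/-- The tail of the minimum estimator. -/
lemma minEstimatorTail_eq {α : ℝ} {μ : Measure ℝ} {N M : ℕ} {x : Fin N → ℝ} {i : Fin N}
    {ε : ℝ} {Ω : Type*} [MeasurableSpace Ω] {P : Measure Ω} [IsProbabilityMeasure P]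
    {s : Fin N → Fin M → Ω → ℝ} (h0 : 0 < α) (h1 : α < 1) (h : IsMaxSkewedStable α μ)
    (hM : 0 < M) (hx : ∀ l, 0 ≤ x l) (hε : 0 ≤ ε) (hθ : 0 < thetaExcept α x i)
    (hs : IsIIDDesign P μ s) :
    minEstimatorTail P x s i ε = (1 - ratioDistr α (ε / thetaExcept α x i)) ^ M := by
  have := h.isProbabilityMeasure
  have := isProbabilityMeasure_ratioLaw μ
  -- A nonempty index makes the infimum a genuine minimum, at least `ε + x i` exactly when every
  -- term is.
  have : Nonempty (Fin M) := ⟨⟨0, hM⟩⟩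
  set θ := thetaExcept α x i with hθd
  let B : Set (Fin N → ℝ) := {v | ε ≤ (∑ l, x l * v l) / v i - x i}
  have hB : MeasurableSet B := measurableSet_le measurable_const (by fun_prop)
  obtain ⟨hcm, hcl⟩ := hs.map_columns
  have hset : {ω | minEstimator x s i ω - x i ≥ ε} =
      (fun ω (j : Fin M) (i : Fin N) => s i j ω) ⁻¹' (univ.pi fun _ => B) := by
    ext ω
    simp only [mem_ofPred_eq, mem_preimage, mem_univ_pi, ge_iff_le, le_sub_iff_add_le,
      minEstimator, B, measurement]
    exact le_ciInf_iff (finite_range _).bddBelow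
  have hcol : (Measure.pi fun _ : Fin N => μ).real B = 1 - ratioDistr α (ε / θ) := by
    have hpos : ∀ᵐ v ∂(Measure.pi fun _ : Fin N => μ), 0 < v i :=
      (measurePreserving_eval (fun _ : Fin N => μ) i).quasiMeasurePreserving.ae (h.ae_pos h0 h1)
    have hC : MeasurableSet {S : ℝ × ℝ | ε ≤ S.2 / S.1} :=
      measurableSet_le measurable_const (by fun_prop)
    have e1 : (Measure.pi fun _ : Fin N => μ).real B = (Measure.pi fun _ : Fin N => μ).real
        ((fun v => (v i, ∑ l ∈ Finset.univ.erase i, x l * v l)) ⁻¹'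
          {S : ℝ × ℝ | ε ≤ S.2 / S.1}) := by
      refine measureReal_congr ?_
      filter_upwards [hpos] with v hv
      refine propext ?_
      change ε ≤ (∑ l, x l * v l) / v i - x i ↔
        ε ≤ (∑ l ∈ Finset.univ.erase i, x l * v l) / v i
      rw [← Finset.add_sum_erase _ _ (Finset.mem_univ i), add_div, mul_div_cancel_right₀ _ hv.ne',
        add_sub_cancel_left]
    rw [e1, ← map_measureReal_apply (by fun_prop) hC, h.map_entry_sum h0 hx,
      map_measureReal_apply (by fun_prop) hC, ← (h.ratioLaw_Iio h0 h1 (div_nonneg hε hθ.le)).1,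
      ← probReal_compl_eq_one_sub measurableSet_Iio, compl_Iio, ratioLaw,
      map_measureReal_apply measurable_ratio measurableSet_Ici]
    congr 1
    ext S
    simp only [mem_preimage, mem_ofPred_eq, mem_Ici, ← hθd]
    rw [mul_div_assoc, div_le_iff₀' hθ]
  rw [minEstimatorTail, hset, ← map_measureReal_apply_of_aemeasurable hcm
    (MeasurableSet.univ_pi fun _ => hB), hcl, measureReal_def, Measure.pi_pi,
    ENNReal.toReal_prod]
  simp [← measureReal_def, hcol]

theorem lemma5 :
    ∃ c C : ℝ, 0 < c ∧ 0 < C ∧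
      ∀ (α : ℝ) (μ : Measure ℝ) (N M : ℕ) (x : Fin N → ℝ) (i : Fin N) (ε : ℝ)
        (Ω : Type*) [MeasurableSpace Ω] (P : Measure Ω) [IsProbabilityMeasure P]
        (s : Fin N → Fin M → Ω → ℝ),
        0 < α → α < 1 → IsMaxSkewedStable α μ → 0 < M → (∀ l, 0 ≤ x l) → 0 ≤ ε →
        0 < thetaExcept α x i → IsIIDDesign P μ s →
        -- the exact tail
        minEstimatorTail P x s i ε =
            (1 - ratioCDF α μ ((ε / thetaExcept α x i) ^ (α / (1 - α)))) ^ M ∧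
        -- the convenient upper bound
        (ε ≤ thetaExcept α x i →
          minEstimatorTail P x s i ε ≤
            (1 / (1 + (ε / thetaExcept α x i) ^ (α / (1 - α)))) ^ M) ∧
        -- the order: the subtracted probability lies between two absolute constants times
        -- `ε ^ α / θ_i ^ α`
        (α ≤ 1 / 2 → ε / thetaExcept α x i < α →
          ∃ δ : ℝ, δ = ratioCDF α μ ((ε / thetaExcept α x i) ^ (α / (1 - α))) ∧
            c * (ε ^ α / thetaExcept α x i ^ α) ≤ δ ∧
            δ ≤ C * (ε ^ α / thetaExcept α x i ^ α) ∧
            minEstimatorTail P x s i ε = (1 - δ) ^ M) ∧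
        -- the closed form at `α = 1 / 2`
        (α = 1 / 2 →
          minEstimatorTail P x s i ε =
            (1 - 2 / Real.pi * Real.arctan (√(ε / thetaExcept α x i))) ^ M) := by
  -- The constants of `rpow_div_pi_le_ratioDistr` and `ratioDistr_le_rpow`.
  refine ⟨1 / Real.pi, 1, by positivity, one_pos, ?_⟩
  intro α μ N M x i ε Ω _ P _ s h0 h1 h hM hx hε hθ hs
  have := h.isProbabilityMeasure
  have hr : 0 ≤ ε / thetaExcept α x i := div_nonneg hε hθ.le
  have htail := minEstimatorTail_eq h0 h1 h hM hx hε hθ hs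
  rw [ratioCDF_eq_ratioDistr h0 h1 h hr, htail]
  refine ⟨rfl, fun hle => ?_, fun hα hlt => ⟨_, rfl, ?_, ?_, rfl⟩, fun hα => ?_⟩
  · have hr1 : ε / thetaExcept α x i ≤ 1 := (div_le_one hθ).2 hle
    have hp := Real.rpow_nonneg hr (α / (1 - α))
    refine pow_le_pow_left₀ ?_ ?_ M
    · rw [← ratioCDF_eq_ratioDistr h0 h1 h hr, sub_nonneg]
      exact measureReal_le_one
    · rw [le_div_iff₀ (by positivity)]
      have := rpow_le_ratioDistr_mul h0 h1 hr hr1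
      linarith
  · rw [← Real.div_rpow hε hθ.le]
    exact rpow_div_pi_le_ratioDistr h0 hα hr (by linarith)
  · rw [← Real.div_rpow hε hθ.le, one_mul]
    exact ratioDistr_le_rpow h0 hα hr
  · subst hα
    rw [ratioDistr_half hr]
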